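/- **Setting.** For integers $M\ge 1$ consider the $M$-coin quantum walk on $\mathbb Z$: the state space is $\ell^2(\mathbb Z)\otimes(\mathbb C^2)^{\otimes M}$ with basis $|x,\xi_{M-1},\dots,\xi_0\rangle$, $x\in\mathbb Z$, $\xi_i\in\{1,-1\}$. At time $t=1,2,\dots$, with $j=t \bmod M$, one first applies the Hadamard matrix $H=\frac1{\sqrt2}\begin{bmatrix}1&1\\1&-1\end{bmatrix}$ to the $j$-th coin and then the shift $|x,\dots,\xi_j,\dots\rangle\mapsto|x+\xi_j,\dots,\xi_j,\dots\rangle$. The walk starts at $x=0$ with initial coin state * Case (A): $\varphi_0^{\otimes M}$, where $\varphi_0={}^T[1/\sqrt2,\,i/\sqrt2]$; * Case (B): $|\phi_{M-1}\rangle\otimes\cdots\otimes|\phi_0\rangle$, where $\phi_0,\dots,\phi_{M-1}$ are i.i.d. with $\Pr(\phi_j=1)=\Pr(\phi_j=-1)=1/2$. The position $X_t^{[M]}$ at time $t$ has the distribution $P(X^{[M]}_t=x)=\|\Phi^{[M]}_t(x)\|^2$, where $\Phi_t^{[M]}(x)\in(\mathbb C^2)^{\otimes M}$ is the coin state at time $t$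 and position $x$ (averaged over the random initial state in Case (B)). Write $\Rightarrow$ for weak convergence, let $t=dM$, and denote the following weak limits (which exist) by: * $Y^{[M]}$ (Case (A)) and $Z^{[M]}$ (Case (B)): the limits of $X_t^{[M]}/t$ as $d\to\infty$ with $M\ge1$ fixed; * $Y_d$: the limit of $X_t^{[M]}/t$ in Case (A), and $Z_d$: the limit of $X_t^{[M]}/\sqrt t$ in Case (B), as $M\to\infty$ with $d\ge2$ fixed. Let $\mathcal X$ and $\mathcal Z$ be independent, $\mathcal X$ standard normal and $\mathcal Z$ with density $\dfrac{1}{\pi(1-x^2)\sqrt{1-2x^2}}$ on $(-1/\sqrt2,1/\sqrt2)$ (and $0$ elsewhere). **Proposition.** 1. $\sqrt M\,Z^{[M]}\Rightarrow\mathcal X\mathcal Z$ as $M\to\infty$, and $Z_d/\sqrt d\Rightarrow\mathcal X\mathcal Z$ as $d\to\infty$. 2. In Case (A), let $0<\beta<1$ and let $t=dM\to\infty$ with $d\sim t^{\beta}$ and $M\sim t^{1-\beta}$ (where $f\sim g$ means $f/g\to1$). Then $X_t^{[M]}/t\Rightarrow Y$, where $Y$ has the density $$f(x)=\frac{3}{\pi(1+x^2)\sqrt{1-8x^2}}\quad\text{on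 }(-1/\sqrt8,1/\sqrt8)$$ (and $0$ elsewhere). Furthermore $Y^{[M]}\Rightarrow Y$ as $M\to\infty$, and $Y_d\Rightarrow Y$ as $d\to\infty$. -/

import Mathlib

open MeasureTheory ProbabilityTheory Filter Topology

noncomputable section

namespace ManyCoinWalk

/-- A wave function of the walk with `M` coins: the amplitude of `|x, ξ⟩` at each position `x : ℤ`
and each coin configuration `ξ : Fin M → {1, -1}` (chiralities are the units of `ℤ`). -/
abbrev Wave (M : ℕ) : Type := ℤ → (Fin M → ℤˣ) → ℂ

/-- The Hadamard matrix, in the basis `|1⟩, |-1⟩`. -/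
def hadamard : Matrix ℤˣ ℤˣ ℂ := fun a b =>
  if a = -1 ∧ b = -1 then -(1 / (Real.sqrt 2 : ℂ)) else 1 / (Real.sqrt 2 : ℂ)

/-- The coin flip: `hadamard` acts on the `j`-th coin. -/
def coinFlip {M : ℕ} (j : Fin M) (Φ : Wave M) : Wave M := fun x ξ =>
  ∑ a : ℤˣ, hadamard (ξ j) a * Φ x (Function.update ξ j a)

/-- The shift `|x, ξ⟩ ↦ |x + ξ_j, ξ⟩`. -/
def shift {M : ℕ} (j : Fin M) (Φ : Wave M) : Wave M := fun x ξ => Φ (x - (ξ j : ℤ)) ξ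

/-- The wave function after `t` steps from `Φ₀`: the step number `t` uses the coin `t mod M`.
(There is no walk with `M = 0` coins; the value there is immaterial.) -/
def evolve {M : ℕ} (Φ₀ : Wave M) : ℕ → Wave M
  | 0 => Φ₀
  | t + 1 =>
    if h : 0 < M then
      shift ⟨(t + 1) % M, Nat.mod_lt _ h⟩ (coinFlip ⟨(t + 1) % M, Nat.mod_lt _ h⟩ (evolve Φ₀ t))
    else evolve Φ₀ t

/-- The walker at the origin with the product coin state `⨂ⱼ φ j`. -/
def productState {M : ℕ} (φ : Fin M → ℤˣ → ℂ) : Wave M := fun x ξ =>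
  if x = 0 then ∏ j, φ j (ξ j) else 0

/-- The squared norm of the coin state at position `x`. -/
def prob {M : ℕ} (Φ : Wave M) (x : ℤ) : ℝ := ∑ ξ : Fin M → ℤˣ, ‖Φ x ξ‖ ^ 2

theorem sum_units {β : Type*} [AddCommMonoid β] (f : ℤˣ → β) : ∑ a : ℤˣ, f a = f 1 + f (-1) := by
  rw [UnitsInt.univ, Finset.sum_pair (by decide)]

theorem prob_coinFlip {M : ℕ} (j : Fin M) (Φ : Wave M) (x : ℤ) :
    prob (coinFlip j Φ) x = prob Φ x := by
  have hinv : Function.Involutive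
      (fun ξ : Fin M → ℤˣ => Function.update ξ j (-(ξ j))) := by
    intro ξ
    simp
  have key : ∀ F : (Fin M → ℤˣ) → ℝ,
      2 * ∑ ξ, F ξ = ∑ ξ, (F ξ + F (Function.update ξ j (-(ξ j)))) := by
    intro F
    rw [Finset.sum_add_distrib, two_mul]
    congr 1
    exact (Equiv.sum_comp hinv.toPerm F).symm
  have h2 : (2 : ℝ) * prob (coinFlip j Φ) x = 2 * prob Φ x := by
    unfold prob
    rw [key, key]
    refine Finset.sum_congr rfl fun ξ _ => ?_
    have hs : ‖(1 / (Real.sqrt 2 : ℂ))‖ ^ 2 = 1 / 2 := by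
      rw [norm_div, Complex.norm_real, div_pow, Real.norm_eq_abs, sq_abs, Real.sq_sqrt] <;> norm_num
    have par : ∀ u v : ℂ, ‖u + v‖ ^ 2 + ‖u - v‖ ^ 2 = 2 * (‖u‖ ^ 2 + ‖v‖ ^ 2) := by
      intro u v
      have := parallelogram_law_with_norm ℝ u v
      nlinarith
    have par' : ∀ u v : ℂ, ‖(1 / (Real.sqrt 2 : ℂ)) * u + (1 / (Real.sqrt 2 : ℂ)) * v‖ ^ 2
        + ‖(1 / (Real.sqrt 2 : ℂ)) * u + -(1 / (Real.sqrt 2 : ℂ)) * v‖ ^ 2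
        = ‖u‖ ^ 2 + ‖v‖ ^ 2 := by
      intro u v
      have e1 : (1 / (Real.sqrt 2 : ℂ)) * u + (1 / (Real.sqrt 2 : ℂ)) * v
        = (1 / (Real.sqrt 2 : ℂ)) * (u + v) := by ring
      have e2 : (1 / (Real.sqrt 2 : ℂ)) * u + -(1 / (Real.sqrt 2 : ℂ)) * v
        = (1 / (Real.sqrt 2 : ℂ)) * (u - v) := by ring
      rw [e1, e2, norm_mul, norm_mul, mul_pow, mul_pow, hs]
      linarith [par u v]
    have hne : ¬ ((1 : ℤˣ) = -1) := by decide
    rcases Int.units_eq_one_or (ξ j) with h | h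
    · have hu : Function.update ξ j 1 = ξ := by rw [← h]; simp
      simp only [coinFlip, sum_units, hadamard, h, Function.update_self, Function.update_idem, hne,
        hu, if_true, if_false, and_self, and_false, false_and]
      exact par' _ _
    · have hu : Function.update ξ j (-1) = ξ := by rw [← h]; simp
      simp only [coinFlip, sum_units, hadamard, h, Function.update_self, Function.update_idem, hne,
        hu, if_true, if_false, and_self, and_false, false_and, neg_neg]
      rw [add_comm, par', add_comm]
  linarith

theorem tsum_prob_eq {M : ℕ} (Φ : Wave M) :
    ∑' x, ENNReal.ofReal (prob Φ x) = ∑ ξ, ∑' x, ENNReal.ofReal (‖Φ x ξ‖ ^ 2) := by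
  rw [← Summable.tsum_finsetSum (fun _ _ => ENNReal.summable)]
  refine tsum_congr fun x => ?_
  exact ENNReal.ofReal_sum_of_nonneg fun _ _ => by positivity

theorem tsum_prob_shift {M : ℕ} (j : Fin M) (Φ : Wave M) :
    ∑' x, ENNReal.ofReal (prob (shift j Φ) x) = ∑' x, ENNReal.ofReal (prob Φ x) := by
  rw [tsum_prob_eq, tsum_prob_eq]
  refine Finset.sum_congr rfl fun ξ _ => ?_
  exact (Equiv.subRight (ξ j : ℤ)).tsum_eq (fun x => ENNReal.ofReal (‖Φ x ξ‖ ^ 2))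

theorem tsum_prob_evolve {M : ℕ} (Φ₀ : Wave M) (t : ℕ) :
    ∑' x, ENNReal.ofReal (prob (evolve Φ₀ t) x) = ∑' x, ENNReal.ofReal (prob Φ₀ x) := by
  induction t with
  | zero => rfl
  | succ t ih =>
    rw [evolve]
    split_ifs with h
    · rw [tsum_prob_shift]
      simp only [prob_coinFlip]
      exact ih
    · exact ih

theorem tsum_prob_productState {M : ℕ} (φ : Fin M → ℤˣ → ℂ)
    (hφ : ∀ j, ∑ a, ‖φ j a‖ ^ 2 = 1) :
    ∑' x, ENNReal.ofReal (prob (productState φ) x) = 1 := by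
  rw [tsum_eq_single 0]
  · have : prob (productState φ) 0 = ∏ j, ∑ a, ‖φ j a‖ ^ 2 := by
      rw [Finset.prod_univ_sum, Fintype.piFinset_univ]
      simp [prob, productState, Finset.prod_pow]
    rw [this, Finset.prod_congr rfl fun j _ => hφ j]
    simp
  · intro x hx
    simp [prob, productState, hx]

/-- The distribution of the position `X_t` of the walk with `M` coins that starts at the origin in
the product coin state `⨂ⱼ φ j`, each `φ j` being a unit vector: `P(X_t = x)` is the squared norm
of the coin state at time `t` and position `x`. -/
def position {M : ℕ} (φ : Fin M → ℤˣ → ℂ) (hφ : ∀ j, ∑ a, ‖φ j a‖ ^ 2 = 1) (t : ℕ) : PMF ℤ :=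
  ⟨fun x => ENNReal.ofReal (prob (evolve (productState φ) t) x), by
    rw [← tsum_prob_productState φ hφ, ← tsum_prob_evolve (productState φ) t]
    exact ENNReal.summable.hasSum⟩

/-- The qubit `(1/√2, i/√2)`. -/
def symQubit : ℤˣ → ℂ := fun a =>
  if a = 1 then 1 / (Real.sqrt 2 : ℂ) else Complex.I / (Real.sqrt 2 : ℂ)

theorem symQubit_norm : ∑ a, ‖symQubit a‖ ^ 2 = 1 := by
  have hne : ¬ ((-1 : ℤˣ) = 1) := by decide
  rw [sum_units]
  simp only [symQubit, if_true, hne, if_false, norm_div, Complex.norm_real, div_pow,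
    Real.norm_eq_abs, sq_abs, Complex.norm_I, norm_one]
  rw [Real.sq_sqrt] <;> norm_num

theorem single_norm (b : ℤˣ) : ∑ a, ‖(Pi.single b 1 : ℤˣ → ℂ) a‖ ^ 2 = 1 := by
  rw [Finset.sum_eq_single b]
  · simp
  · intro a _ hab
    rw [Pi.single_eq_of_ne hab]
    simp
  · intro hb
    exact absurd (Finset.mem_univ b) hb

/-- Case (A): every coin starts in the state `(1/√2, i/√2)`. -/
def positionA (M t : ℕ) : PMF ℤ := position (fun _ : Fin M => symQubit) (fun _ => symQubit_norm) t

/-- Case (B): the coins start in independent random basis states, `|1⟩` or `|-1⟩` with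
probability `1/2` each. -/
def positionB (M t : ℕ) : PMF ℤ :=
  (PMF.uniformOfFintype (Fin M → ℤˣ)).bind fun η =>
    position (fun j => Pi.single (η j) 1) (fun j => single_norm (η j)) t

/-- The law of `X / s` when `X` has distribution `p`. -/
def scaledLaw (p : PMF ℤ) (s : ℝ) : ProbabilityMeasure ℝ :=
  ⟨p.toMeasure.map (fun x : ℤ => (x : ℝ) / s),
    Measure.isProbabilityMeasure_map (measurable_of_countable _).aemeasurable⟩

/-- The law of `c * W` when `W` has law `P`. -/
def mulLaw (c : ℝ) (P : ProbabilityMeasure ℝ) : ProbabilityMeasure ℝ :=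
  P.map (f := fun w => c * w) (measurable_const_mul c).aemeasurable

/-- Weak convergence of a sequence of probability measures to the measure `ν`, which is asserted to
be a probability measure. -/
def ConvergesWeakly (P : ℕ → ProbabilityMeasure ℝ) (ν : Measure ℝ) : Prop :=
  ∃ h : IsProbabilityMeasure ν, Tendsto P atTop (𝓝 ⟨ν, h⟩)

/-- The limit density of the symmetric Hadamard walk. -/
def konnoDensity : ℝ → ℝ :=
  (Set.Ioo (-(1 / Real.sqrt 2)) (1 / Real.sqrt 2)).indicator
    fun x => 1 / (Real.pi * (1 - x ^ 2) * Real.sqrt (1 - 2 * x ^ 2))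

/-- The law with density `konnoDensity`. -/
def konnoLaw : Measure ℝ := volume.withDensity fun x => ENNReal.ofReal (konnoDensity x)

/-- The law of the product of two independent random variables, one standard normal and one
with density `konnoDensity`. -/
def productLaw : Measure ℝ := ((gaussianReal 0 1).prod konnoLaw).map fun p => p.1 * p.2

/-- The density `3 / (π (1 + x²) √(1 - 8 x²))` on `(-1/√8, 1/√8)`. -/
def limitDensity : ℝ → ℝ :=
  (Set.Ioo (-(1 / Real.sqrt 8)) (1 / Real.sqrt 8)).indicator
    fun x => 3 / (Real.pi * (1 + x ^ 2) * Real.sqrt (1 - 8 * x ^ 2))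

/-- The law with density `limitDensity`. -/
def limitLaw : Measure ℝ := volume.withDensity fun x => ENNReal.ofReal (limitDensity x)

end ManyCoinWalk

end

noncomputable section

namespace ManyCoinWalk


/-! The Fourier transform in position turns the shift by coin `j` into multiplication by `exp(± i
k)`. For fixed wave number `k` a product coin state therefore stays a product, each coin evolving by
the 2×2 unitary U(k) = `coinStep k`. At time t = dM every coin has been used exactly d times. By
Parseval, the characteristic function of the position at ε is the average over `k` of the product
over the coins of the overlaps of U(k)^d φ_j and U(k+ε)^d φ_j. In Case (A) this is the M-th power of
one overlap; in Case (B), after averaging over the initial states, it is the M-th power of the mean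
of the two basis overlaps.

U(k) is i times a rotation by the angle `phase k` about the unit axis n = (v, w, v) with v =
`velocity` = `phase'` and w = `tilt`, so U(k)^d is explicit (`coinStep_iterate`). The mean overlap
is a real number R, the inner product of the unit vectors (cos(d phase), sin(d phase) n) at k and
k+ε. The overlap in Case (A) is R + iJ, where J sees only the component w of the axis
(`overlap_symQubit`).

Put ε = θ/s with s the scale. For d → ∞ with M fixed and s = t, R tends to cos(vθ/M) and J to w
sin(vθ/M). For M → ∞ the principle (1 + z/M)^M → e^z reduces everything to the limit of M(R - 1 +
iJ). In Case (A) the first order survives, iθvw in the end; in Case (B) the first order is absent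
and the second gives -θ²v²/2. What depends on sin(d phase) disappears as d → ∞. All integrands are
bounded by 1, so dominated convergence and Lévy's theorem give weak convergence.

It remains to push the uniform law of `k` forward. Under `velocity` it becomes the Konno law
(`map_velocity_waveLaw`), so the average of exp(-θ²v²/2) is the characteristic function of the
product law; under `drift` = vw it becomes the limit law of Case (A) (`map_drift_waveLaw`). -/

/-! ### Fourier transform of the walk and decoupling of the coins. -/

/-- The Fourier transform of a wave function in the position variable. -/
def fourier {M : ℕ} (Φ : Wave M) (k : ℝ) (ξ : Fin M → ℤˣ) : ℂ :=
  ∑' x : ℤ, Φ x ξ * Complex.exp (Complex.I * k * x)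

/-- One step of the one-coin walk at wave number `k`. -/
def coinStep (k : ℝ) (φ : ℤˣ → ℂ) : ℤˣ → ℂ := fun b =>
  Complex.exp (Complex.I * k * ((b : ℤ) : ℂ)) * ∑ a : ℤˣ, hadamard b a * φ a

theorem fourier_shift {M : ℕ} (j : Fin M) (Φ : Wave M) (k : ℝ) (ξ : Fin M → ℤˣ) :
    fourier (shift j Φ) k ξ
      = Complex.exp (Complex.I * k * ((ξ j : ℤ) : ℂ)) * fourier Φ k ξ := by
  unfold fourier
  rw [← tsum_mul_left, ← (Equiv.addRight (ξ j : ℤ)).tsum_eq]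
  refine tsum_congr fun x => ?_
  simp only [shift, Equiv.coe_addRight, add_sub_cancel_right, Int.cast_add, mul_add,
    Complex.exp_add]
  ring

theorem fourier_coinFlip {M : ℕ} (j : Fin M) (Φ : Wave M) (s : Finset ℤ)
    (hs : ∀ x ∉ s, ∀ ξ, Φ x ξ = 0) (k : ℝ) (ξ : Fin M → ℤˣ) :
    fourier (coinFlip j Φ) k ξ
      = ∑ a : ℤˣ, hadamard (ξ j) a * fourier Φ k (Function.update ξ j a) := by
  have h1 : ∀ η, fourier Φ k η = ∑ x ∈ s, Φ x η * Complex.exp (Complex.I * k * x) := fun η =>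
    tsum_eq_sum fun x hx => by rw [hs x hx, zero_mul]
  have h2 : fourier (coinFlip j Φ) k ξ
      = ∑ x ∈ s, coinFlip j Φ x ξ * Complex.exp (Complex.I * k * x) :=
    tsum_eq_sum fun x hx => by simp [coinFlip, hs x hx]
  rw [h2]
  simp only [h1, Finset.mul_sum]
  rw [Finset.sum_comm]
  refine Finset.sum_congr rfl fun x _ => ?_
  simp only [coinFlip, Finset.sum_mul, mul_assoc]

/-- Flip and shift involve coin `j` alone, so the other factors pull out of the sum over its
chirality. The finite support `s` lets that sum be exchanged with the sum over positions. -/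
theorem fourier_step_prod {M : ℕ} (j : Fin M) (Φ : Wave M) (s : Finset ℤ)
    (hs : ∀ x ∉ s, ∀ ξ, Φ x ξ = 0) (k : ℝ) (ψ : Fin M → ℤˣ → ℂ)
    (h : ∀ ξ, fourier Φ k ξ = ∏ i, ψ i (ξ i)) (ξ : Fin M → ℤˣ) :
    fourier (shift j (coinFlip j Φ)) k ξ
      = ∏ i, (if i = j then coinStep k (ψ i) else ψ i) (ξ i) := by
  rw [fourier_shift, fourier_coinFlip j Φ s hs]
  have key : ∀ η : Fin M → ℤˣ, ∀ χ : Fin M → ℤˣ → ℂ,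
      ∏ i, χ i (η i) = χ j (η j) * ∏ i ∈ Finset.univ.erase j, χ i (η i) := fun η χ =>
    (Finset.mul_prod_erase _ _ (Finset.mem_univ j)).symm
  rw [key ξ]
  simp only [h, key _ ψ, Function.update_self, if_true]
  have h1 : ∀ a, ∏ i ∈ Finset.univ.erase j, ψ i (Function.update ξ j a i)
      = ∏ i ∈ Finset.univ.erase j, ψ i (ξ i) := fun a =>
    Finset.prod_congr rfl fun i hi => by rw [Function.update_of_ne (Finset.ne_of_mem_erase hi)]
  have h2 : ∏ i ∈ Finset.univ.erase j, (if i = j then coinStep k (ψ i) else ψ i) (ξ i)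
      = ∏ i ∈ Finset.univ.erase j, ψ i (ξ i) :=
    Finset.prod_congr rfl fun i hi => by rw [if_neg (Finset.ne_of_mem_erase hi)]
  rw [h2]
  simp only [h1, coinStep, Finset.mul_sum, Finset.sum_mul]
  exact Finset.sum_congr rfl fun a _ => by ring

/-- The walker moves one site per step; all sums over positions are thereby finite. -/
theorem evolve_eq_zero {M : ℕ} (φ : Fin M → ℤˣ → ℂ) (t : ℕ) :
    ∀ x ∉ Finset.Icc (-(t : ℤ)) t, ∀ ξ, evolve (productState φ) t x ξ = 0 := by
  induction t with
  | zero =>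
    intro x hx ξ
    have : x ≠ 0 := by rintro rfl; simp at hx
    simp [evolve, productState, this]
  | succ t ih =>
    intro x hx ξ
    rw [evolve]
    split_ifs with h
    · simp only [shift, coinFlip]
      refine Finset.sum_eq_zero fun a _ => ?_
      rw [ih, mul_zero]
      simp only [Finset.mem_Icc, not_and_or, not_le] at hx ⊢
      push_cast at hx
      rcases Int.units_eq_one_or (ξ ⟨(t + 1) % M, Nat.mod_lt _ h⟩) with e | e <;> rw [e] <;>
        simp <;> omega
    · refine ih x ?_ ξ
      simp only [Finset.mem_Icc, not_and_or, not_le] at hx ⊢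
      push_cast at hx
      omega

/-- The number of times the coin `j` has been used after `t` steps. -/
def useCount (M j t : ℕ) : ℕ := (t + (M - j) % M) / M

theorem useCount_zero {M j : ℕ} (hM : 0 < M) : useCount M j 0 = 0 := by
  rw [useCount, zero_add, Nat.div_eq_of_lt (Nat.mod_lt _ hM)]

theorem useCount_mul {M j d : ℕ} (hM : 0 < M) : useCount M j (d * M) = d := by
  rw [useCount, mul_comm, Nat.mul_add_div hM, Nat.div_eq_of_lt (Nat.mod_lt _ hM), add_zero]

/-- The offset `(M - j) % M` is `-j` modulo `M`, so the quotient jumps exactly at times congruent to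
`j`. The outer reduction gives coin 0 the offset 0: its first use is at time `M`, not at time 0. -/
theorem useCount_succ {M j t : ℕ} (hj : j < M) :
    useCount M j (t + 1) = useCount M j t + if j = (t + 1) % M then 1 else 0 := by
  have h1 : t + 1 + (M - j) % M = t + (M - j) % M + 1 := by ring
  rw [useCount, useCount, h1, Nat.succ_div, ← h1]
  congr 1
  refine if_congr ?_ rfl rfl
  have h2 : (M ∣ t + 1 + (M - j) % M) ↔ M ∣ t + 1 + (M - j) := by
    rw [Nat.dvd_iff_mod_eq_zero, Nat.dvd_iff_mod_eq_zero, Nat.add_mod_mod]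
  rw [h2]
  have h3 : (t + 1 + (M - j)) % M = ((t + 1) % M + (M - j)) % M := by rw [Nat.mod_add_mod]
  rw [Nat.dvd_iff_mod_eq_zero, h3, ← Nat.dvd_iff_mod_eq_zero]
  have h4 : (t + 1) % M < M := Nat.mod_lt _ (by omega)
  constructor
  · rintro ⟨c, hc⟩
    -- The multiple `M * c` lies strictly between 0 and `2 * M`.
    have : c = 1 := by
      have hc0 : c ≠ 0 := by rintro rfl; omega
      have hc2 : c < 2 := by
        by_contra hge
        have : M * 2 ≤ M * c := Nat.mul_le_mul_left _ (by omega)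
        omega
      omega
    subst this
    omega
  · intro h
    exact ⟨1, by omega⟩

theorem fourier_evolve {M : ℕ} (hM : 0 < M) (φ : Fin M → ℤˣ → ℂ) (k : ℝ) (t : ℕ)
    (ξ : Fin M → ℤˣ) :
    fourier (evolve (productState φ) t) k ξ
      = ∏ i : Fin M, (coinStep k)^[useCount M i t] (φ i) (ξ i) := by
  induction t generalizing ξ with
  | zero =>
    simp only [evolve, useCount_zero hM, Function.iterate_zero, id]
    rw [fourier, tsum_eq_single 0]
    · simp [productState]
    · intro x hx
      simp [productState, hx]
  | succ t ih =>
    rw [evolve, dif_pos hM, fourier_step_prod _ _ _ (evolve_eq_zero φ t) k _ ih]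
    refine Finset.prod_congr rfl fun i _ => ?_
    rw [useCount_succ i.2]
    by_cases h : i = ⟨(t + 1) % M, Nat.mod_lt _ hM⟩
    · rw [if_pos h, if_pos (by rw [h]), Function.iterate_succ_apply']
    · rw [if_neg h, if_neg (fun e => h (Fin.ext e)), add_zero]

/-! ### Parseval's identity and characteristic functions of the position. -/

/-- The uniform law on the period `(a, a + 2π]` of wave numbers. -/
def waveLaw (a : ℝ) : Measure ℝ :=
  ENNReal.ofReal (1 / (2 * Real.pi)) • volume.restrict (Set.Ioc a (a + 2 * Real.pi))

instance (a : ℝ) : IsProbabilityMeasure (waveLaw a) := by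
  constructor
  rw [waveLaw, Measure.smul_apply, Measure.restrict_apply_univ, Real.volume_Ioc, smul_eq_mul,
    ← ENNReal.ofReal_mul (by positivity), add_sub_cancel_left, one_div_mul_cancel (by positivity),
    ENNReal.ofReal_one]

theorem integral_waveLaw_exp (a : ℝ) (n : ℤ) :
    ∫ k, Complex.exp (Complex.I * n * k) ∂(waveLaw a) = if n = 0 then 1 else 0 := by
  split_ifs with h
  · simp [h]
  · have hpi : (0 : ℝ) < 2 * Real.pi := by positivity
    rw [waveLaw, integral_smul_measure,
      ← intervalIntegral.integral_of_le (by linarith), integral_exp_mul_complex]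
    · have : Complex.exp (Complex.I * n * ((a + 2 * Real.pi : ℝ) : ℂ))
          = Complex.exp (Complex.I * n * a) := by
        rw [show Complex.I * n * ((a + 2 * Real.pi : ℝ) : ℂ)
          = Complex.I * n * a + n * (2 * Real.pi * Complex.I) by push_cast; ring,
          Complex.exp_add, Complex.exp_int_mul_two_pi_mul_I, mul_one]
      rw [this, sub_self, zero_div, smul_zero]
    · simp [h, Complex.I_ne_zero]

theorem integrable_waveLaw (a : ℝ) {f : ℝ → ℂ} (hf : Continuous f) : Integrable f (waveLaw a) :=
  ((hf.continuousOn.integrableOn_Icc (a := a) (b := a + 2 * Real.pi)).mono_set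
    Set.Ioc_subset_Icc_self).smul_measure ENNReal.ofReal_ne_top

theorem continuous_sum_mul_exp (s : Finset ℤ) (f : ℤ → ℂ) :
    Continuous fun k : ℝ => ∑ x ∈ s, f x * Complex.exp (Complex.I * k * x) := by fun_prop

/-- Orthogonality of the characters leaves the diagonal terms; translating the second factor by `θ`
puts the weight `exp(iθx)` on them. -/
theorem parseval (a : ℝ) (s : Finset ℤ) (f : ℤ → ℂ) (θ : ℝ) :
    ∫ k, (starRingEnd ℂ) (∑ x ∈ s, f x * Complex.exp (Complex.I * k * x))
        * ∑ x ∈ s, f x * Complex.exp (Complex.I * (k + θ : ℝ) * x) ∂(waveLaw a)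
      = ∑ x ∈ s, ((‖f x‖ ^ 2 : ℝ) : ℂ) * Complex.exp (Complex.I * θ * x) := by
  have h1 : ∀ k : ℝ, (starRingEnd ℂ) (∑ x ∈ s, f x * Complex.exp (Complex.I * k * x))
        * ∑ y ∈ s, f y * Complex.exp (Complex.I * (k + θ : ℝ) * y)
      = ∑ x ∈ s, ∑ y ∈ s, (starRingEnd ℂ (f x) * f y * Complex.exp (Complex.I * θ * y))
          * Complex.exp (Complex.I * (y - x : ℤ) * k) := by
    intro k
    rw [map_sum, Finset.sum_mul_sum]
    refine Finset.sum_congr rfl fun x _ => Finset.sum_congr rfl fun y _ => ?_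
    rw [map_mul, ← Complex.exp_conj]
    have e : Complex.exp ((starRingEnd ℂ) (Complex.I * k * x))
        * Complex.exp (Complex.I * (k + θ : ℝ) * y)
        = Complex.exp (Complex.I * θ * y) * Complex.exp (Complex.I * (y - x : ℤ) * k) := by
      rw [← Complex.exp_add, ← Complex.exp_add]
      congr 1
      simp
      ring
    linear_combination (starRingEnd ℂ (f x) * f y) * e
  simp only [h1]
  rw [integral_finsetSum]
  · refine Finset.sum_congr rfl fun x hx => ?_
    rw [integral_finsetSum]
    · simp only [integral_const_mul, integral_waveLaw_exp]
      rw [Finset.sum_eq_single x]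
      · simp [← Complex.normSq_eq_conj_mul_self, Complex.normSq_eq_norm_sq]
      · intro y _ hyx
        rw [if_neg (by omega), mul_zero]
      · intro h; exact absurd hx h
    · intro y _
      exact integrable_waveLaw a (by fun_prop)
  · intro x _
    exact integrable_waveLaw a (by fun_prop)

/-- The overlap of the states reached from `φ` at the wave numbers `k` and `k'` in `d` steps. -/
def overlap (d : ℕ) (φ : ℤˣ → ℂ) (k k' : ℝ) : ℂ :=
  ∑ b : ℤˣ, (starRingEnd ℂ) ((coinStep k)^[d] φ b) * (coinStep k')^[d] φ b

/-- Parseval is applied for each coin configuration; the sum over configurations of a product is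
then the product of one-coin sums. The base point `a` of the period stays free, to be placed later
where the monotonicity of the limit map changes. -/
theorem tsum_prob_exp {M : ℕ} (hM : 0 < M) (φ : Fin M → ℤˣ → ℂ) (a θ : ℝ) (d : ℕ) :
    ∑' x : ℤ, (prob (evolve (productState φ) (d * M)) x : ℂ) * Complex.exp (Complex.I * θ * x)
      = ∫ k, ∏ j, overlap d (φ j) k (k + θ) ∂(waveLaw a) := by
  set s := Finset.Icc (-((d * M : ℕ) : ℤ)) (d * M : ℕ) with hs
  have hz := evolve_eq_zero φ (d * M)
  rw [← hs] at hz
  set Φ := evolve (productState φ) (d * M) with hΦ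
  have hF : ∀ k ξ, ∑ x ∈ s, Φ x ξ * Complex.exp (Complex.I * (k : ℝ) * x)
      = ∏ i, (coinStep k)^[d] (φ i) (ξ i) := by
    intro k ξ
    have := fourier_evolve hM φ k (d * M) ξ
    simp only [useCount_mul hM] at this
    rw [← this, ← hΦ, fourier, tsum_eq_sum fun x hx => by rw [hz x hx, zero_mul]]
  rw [tsum_eq_sum (s := s) fun x hx => by simp [prob, hz x hx]]
  have h1 : ∀ k : ℝ, ∏ j, overlap d (φ j) k (k + θ)
      = ∑ ξ : Fin M → ℤˣ, (starRingEnd ℂ) (∑ x ∈ s, Φ x ξ * Complex.exp (Complex.I * k * x))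
        * ∑ x ∈ s, Φ x ξ * Complex.exp (Complex.I * (k + θ : ℝ) * x) := by
    intro k
    simp only [hF, overlap]
    rw [Finset.prod_univ_sum, Fintype.piFinset_univ]
    refine Finset.sum_congr rfl fun ξ _ => ?_
    rw [Finset.prod_mul_distrib, map_prod]
  simp only [h1]
  rw [integral_finsetSum]
  · simp only [parseval, prob]
    rw [Finset.sum_comm]
    refine Finset.sum_congr rfl fun x _ => ?_
    push_cast
    rw [Finset.sum_mul]
  · intro ξ _
    refine integrable_waveLaw a (Continuous.mul ?_ ?_)
    · exact Complex.continuous_conj.comp (continuous_sum_mul_exp s _)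
    · exact (continuous_sum_mul_exp s fun x => Φ x ξ).comp (continuous_id.add continuous_const)

theorem charFun_scaledLaw (p : PMF ℤ) (s θ : ℝ) :
    charFun (scaledLaw p s : Measure ℝ) θ
      = ∑' x : ℤ, ((p x).toReal : ℂ) * Complex.exp (Complex.I * (θ / s : ℝ) * x) := by
  rw [charFun_apply_real]
  change ∫ x, _ ∂(p.toMeasure.map (fun x : ℤ => (x : ℝ) / s)) = _
  rw [integral_map (measurable_of_countable _).aemeasurable (by fun_prop),
    PMF.integral_eq_tsum]
  · refine tsum_congr fun x => ?_
    rw [Complex.real_smul]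
    congr 2
    push_cast
    ring
  · refine (integrable_const (1 : ℝ)).mono' (measurable_of_countable _).aestronglyMeasurable
      (ae_of_all _ fun x => ?_)
    rw [← Complex.ofReal_mul, Complex.norm_exp_ofReal_mul_I]

theorem position_toReal {M : ℕ} (φ : Fin M → ℤˣ → ℂ) (hφ : ∀ j, ∑ a, ‖φ j a‖ ^ 2 = 1) (t : ℕ)
    (x : ℤ) : (position φ hφ t x).toReal = prob (evolve (productState φ) t) x :=
  ENNReal.toReal_ofReal (Finset.sum_nonneg fun _ _ => by positivity)

theorem charFun_positionA {M : ℕ} (hM : 0 < M) (d : ℕ) (a s θ : ℝ) :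
    charFun (scaledLaw (positionA M (d * M)) s : Measure ℝ) θ
      = ∫ k, overlap d symQubit k (k + θ / s) ^ M ∂(waveLaw a) := by
  rw [charFun_scaledLaw]
  simp only [positionA, position_toReal]
  rw [tsum_prob_exp hM _ a]
  simp

theorem continuous_coinStep_iterate (d : ℕ) (φ : ℤˣ → ℂ) (b : ℤˣ) :
    Continuous fun k : ℝ => (coinStep k)^[d] φ b := by
  induction d generalizing b with
  | zero => exact continuous_const
  | succ d ih =>
    simp only [Function.iterate_succ_apply']
    unfold coinStep at ih ⊢
    refine Continuous.mul (by fun_prop) (continuous_finsetSum _ fun a _ => ?_)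
    exact continuous_const.mul (ih a)

theorem continuous_overlap (d : ℕ) (φ : ℤˣ → ℂ) (ε : ℝ) :
    Continuous fun k : ℝ => overlap d φ k (k + ε) := by
  refine continuous_finsetSum _ fun b _ => ?_
  exact (Complex.continuous_conj.comp (continuous_coinStep_iterate d φ b)).mul
    ((continuous_coinStep_iterate d φ b).comp (continuous_id.add continuous_const))

/-- The initial coin states are independent, so the average of the product of overlaps is the
product of the averaged overlaps. -/
theorem charFun_positionB {M : ℕ} (hM : 0 < M) (d : ℕ) (a s θ : ℝ) :
    charFun (scaledLaw (positionB M (d * M)) s : Measure ℝ) θ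
      = ∫ k, ((1 / 2) * ∑ b : ℤˣ, overlap d (Pi.single b 1) k (k + θ / s)) ^ M
          ∂(waveLaw a) := by
  rw [charFun_scaledLaw]
  have h1 : ∀ x, ((positionB M (d * M) x).toReal : ℂ) = ∑ η : Fin M → ℤˣ, (1 / 2) ^ M *
      (prob (evolve (productState fun j => Pi.single (η j) 1) (d * M)) x : ℂ) := by
    intro x
    rw [positionB, PMF.bind_apply, tsum_fintype, ENNReal.toReal_sum]
    · push_cast
      refine Finset.sum_congr rfl fun η _ => ?_
      rw [ENNReal.toReal_mul, position_toReal, PMF.uniformOfFintype_apply, ENNReal.toReal_inv]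
      push_cast
      simp
    · intro η _
      exact ENNReal.mul_ne_top (PMF.apply_ne_top _ _) (PMF.apply_ne_top _ _)
  simp only [h1, Finset.sum_mul, mul_assoc ((1 / 2 : ℂ) ^ M)]
  rw [Summable.tsum_finsetSum]
  · simp only [tsum_mul_left, tsum_prob_exp hM _ a]
    rw [← Finset.mul_sum, ← integral_finsetSum, ← integral_const_mul]
    · congr 1
      ext k
      have h2 : (∑ b : ℤˣ, overlap d (Pi.single b 1) k (k + θ / s)) ^ M
          = ∏ _j : Fin M, ∑ b : ℤˣ, overlap d (Pi.single b 1) k (k + θ / s) := by simp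
      rw [mul_pow, h2, Finset.prod_univ_sum, Fintype.piFinset_univ]
    · intro η _
      exact integrable_waveLaw a (continuous_finsetProd _ fun j _ => continuous_overlap _ _ _)
  · intro η _
    refine summable_of_ne_finset_zero (s := Finset.Icc (-((d * M : ℕ) : ℤ)) (d * M : ℕ)) ?_
    intro x hx
    simp [prob, evolve_eq_zero _ _ x hx]


/-! ### The one-coin step as a rotation. -/

/-- The eigenvalues of the one-coin step at wave number `k` are `i exp(± i phase k)`. -/
def phase (k : ℝ) : ℝ := Real.arccos (Real.sin k / Real.sqrt 2)

/-- The group velocity, the derivative of `phase`. -/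
def velocity (k : ℝ) : ℝ := -Real.cos k / Real.sqrt (1 + Real.cos k ^ 2)

/-- The second component of the axis of the one-coin step, a rotation; the first and the third
component are both `velocity k`. -/
def tilt (k : ℝ) : ℝ := Real.sin k / Real.sqrt (1 + Real.cos k ^ 2)

theorem sqrt_one_add_cos_sq_pos (k : ℝ) : 0 < Real.sqrt (1 + Real.cos k ^ 2) :=
  Real.sqrt_pos.mpr (by positivity)

theorem axis_unit (k : ℝ) : 2 * velocity k ^ 2 + tilt k ^ 2 = 1 := by
  rw [velocity, tilt, div_pow, div_pow, Real.sq_sqrt (by positivity), neg_sq]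
  have : 1 + Real.cos k ^ 2 ≠ 0 := by positivity
  field_simp
  linarith [Real.sin_sq_add_cos_sq k]

theorem sq_sin_div_sqrt_two (k : ℝ) : (Real.sin k / Real.sqrt 2) ^ 2 = Real.sin k ^ 2 / 2 := by
  rw [div_pow, Real.sq_sqrt (by norm_num)]

theorem abs_sin_div_sqrt_two_lt (k : ℝ) : |Real.sin k / Real.sqrt 2| < 1 := by
  rw [← sq_lt_one_iff_abs_lt_one, sq_sin_div_sqrt_two]
  linarith [Real.sin_sq_add_cos_sq k, sq_nonneg (Real.cos k)]

theorem cos_phase (k : ℝ) : Real.cos (phase k) = Real.sin k / Real.sqrt 2 := by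
  have := abs_lt.mp (abs_sin_div_sqrt_two_lt k)
  exact Real.cos_arccos this.1.le this.2.le

theorem sin_phase (k : ℝ) :
    Real.sin (phase k) = Real.sqrt (1 + Real.cos k ^ 2) / Real.sqrt 2 := by
  rw [phase, Real.sin_arccos, sq_sin_div_sqrt_two, ← Real.sqrt_div (by positivity)]
  congr 1
  linarith [Real.sin_sq_add_cos_sq k]

theorem sin_phase_mul_velocity (k : ℝ) :
    Real.sin (phase k) * velocity k = -(Real.cos k / Real.sqrt 2) := by
  rw [sin_phase, velocity]
  have := (sqrt_one_add_cos_sq_pos k).ne'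
  field_simp

theorem sin_phase_mul_tilt (k : ℝ) :
    Real.sin (phase k) * tilt k = Real.sin k / Real.sqrt 2 := by
  rw [sin_phase, tilt]
  have := (sqrt_one_add_cos_sq_pos k).ne'
  field_simp

/-- The reflection whose `phase`-rotation is the one-coin step. -/
def axisMap (k : ℝ) (φ : ℤˣ → ℂ) : ℤˣ → ℂ := fun b =>
  if b = 1 then velocity k * φ 1 + (velocity k - Complex.I * tilt k) * φ (-1)
  else (velocity k + Complex.I * tilt k) * φ 1 - velocity k * φ (-1)

/-- `axisMap k` is n·σ for the Pauli matrices σ and the axis n, so its square is |n|² = 1 by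
`axis_unit`. -/
theorem axisMap_axisMap (k : ℝ) (φ : ℤˣ → ℂ) : axisMap k (axisMap k φ) = φ := by
  have hne : ¬ ((-1 : ℤˣ) = 1) := by decide
  have h : 2 * (velocity k : ℂ) ^ 2 + (tilt k : ℂ) ^ 2 = 1 := by exact_mod_cast axis_unit k
  ext b
  rcases Int.units_eq_one_or b with rfl | rfl
  · simp only [axisMap, if_true, if_neg hne]
    linear_combination φ 1 * h - φ 1 * (tilt k : ℂ) ^ 2 * Complex.I_sq
  · simp only [axisMap, if_true, if_neg hne]
    linear_combination φ (-1) * h - φ (-1) * (tilt k : ℂ) ^ 2 * Complex.I_sq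

/-- The step has determinant -1, so dividing it by i gives an element of SU(2); half its trace is
sin k / √2, the cosine of `phase k`. -/
theorem coinStep_eq (k : ℝ) (φ : ℤˣ → ℂ) (b : ℤˣ) :
    coinStep k φ b = Complex.I * (Real.cos (phase k) * φ b
      + Complex.I * Real.sin (phase k) * axisMap k φ b) := by
  have hne : ¬ ((-1 : ℤˣ) = 1) := by decide
  have hne' : ¬ ((1 : ℤˣ) = -1) := by decide
  have h0 : (Real.cos (phase k) : ℂ) = Real.sin k / Real.sqrt 2 := by
    exact_mod_cast cos_phase k
  have h1 : (Real.sin (phase k) : ℂ) * velocity k = -(Real.cos k / Real.sqrt 2) := by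
    exact_mod_cast sin_phase_mul_velocity k
  have h2 : (Real.sin (phase k) : ℂ) * tilt k = Real.sin k / Real.sqrt 2 := by
    exact_mod_cast sin_phase_mul_tilt k
  have e1 : Complex.exp (Complex.I * k) = Real.cos k + Real.sin k * Complex.I := by
    rw [mul_comm, Complex.exp_mul_I]; simp
  have e2 : Complex.exp (-(Complex.I * k)) = Real.cos k - Real.sin k * Complex.I := by
    rw [show -(Complex.I * k) = ((-k : ℝ) : ℂ) * Complex.I by push_cast; ring, Complex.exp_mul_I]
    simp; ring
  rcases Int.units_eq_one_or b with rfl | rfl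
  · simp only [coinStep, sum_units, hadamard, hne', axisMap, if_true, if_false,
      false_and, Units.val_one, Int.cast_one, mul_one, e1]
    rw [h0]
    linear_combination
      (-(Complex.I) ^ 2) * (φ 1 + φ (-1)) * h1 + Complex.I ^ 3 * φ (-1) * h2
        + ((φ 1 + φ (-1)) * (Real.cos k / Real.sqrt 2)
          + Complex.I * φ (-1) * (Real.sin k / Real.sqrt 2)) * Complex.I_sq
  · simp only [coinStep, sum_units, hadamard, hne, hne', axisMap, if_true, if_false, and_self,
      and_false, Units.val_neg, Units.val_one, Int.cast_one, mul_one, Int.cast_neg, mul_neg, e2]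
    rw [h0]
    linear_combination
      (-(Complex.I) ^ 2) * (φ 1 - φ (-1)) * h1 - Complex.I ^ 3 * φ 1 * h2
        + ((φ 1 - φ (-1)) * (Real.cos k / Real.sqrt 2)
          - Complex.I * φ 1 * (Real.sin k / Real.sqrt 2)) * Complex.I_sq

theorem axisMap_linear (k : ℝ) (c u v : ℂ) (φ ψ : ℤˣ → ℂ) (b : ℤˣ) :
    axisMap k (fun b => c * (u * φ b + v * ψ b)) b
      = c * (u * axisMap k φ b + v * axisMap k ψ b) := by
  unfold axisMap
  split_ifs <;> ring

/-- De Moivre's formula, with the involution `axisMap k` in the role of a square root of 1. -/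
theorem coinStep_iterate (k : ℝ) (φ : ℤˣ → ℂ) (d : ℕ) :
    (coinStep k)^[d] φ = fun b => Complex.I ^ d * (Real.cos (d * phase k) * φ b
      + Complex.I * Real.sin (d * phase k) * axisMap k φ b) := by
  induction d with
  | zero => ext b; simp
  | succ d ih =>
    ext b
    rw [Function.iterate_succ_apply', ih, coinStep_eq, axisMap_linear, axisMap_axisMap]
    push_cast
    rw [add_mul, one_mul, Complex.cos_add, Complex.sin_add]
    linear_combination (Complex.I ^ (d + 1) * φ b * Complex.sin (phase k)
      * Complex.sin (d * phase k)) * Complex.I_sq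

/-! ### Closed forms of the overlaps. -/

/-- The real part of the overlap of the states reached from `symQubit` at two wave numbers. -/
def overlapReal (d : ℕ) (k k' : ℝ) : ℝ :=
  Real.cos (d * phase k) * Real.cos (d * phase k')
    + (tilt k * tilt k' + 2 * velocity k * velocity k')
      * (Real.sin (d * phase k) * Real.sin (d * phase k'))

/-- The imaginary part of the overlap of the states reached from `symQubit`. -/
def overlapImag (d : ℕ) (k k' : ℝ) : ℝ :=
  tilt k' * (Real.cos (d * phase k) * Real.sin (d * phase k'))
    - tilt k * (Real.sin (d * phase k) * Real.cos (d * phase k'))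

theorem overlap_eq (d : ℕ) (φ : ℤˣ → ℂ) (k k' : ℝ) :
    overlap d φ k k' = ∑ b : ℤˣ, (Real.cos (d * phase k) * (starRingEnd ℂ) (φ b)
        - Complex.I * Real.sin (d * phase k) * (starRingEnd ℂ) (axisMap k φ b))
      * (Real.cos (d * phase k') * φ b + Complex.I * Real.sin (d * phase k') * axisMap k' φ b) := by
  refine Finset.sum_congr rfl fun b _ => ?_
  rw [coinStep_iterate, coinStep_iterate]
  simp only [map_mul, map_add, map_pow, Complex.conj_I, Complex.conj_ofReal]
  have : (-Complex.I) ^ d * Complex.I ^ d = 1 := by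
    rw [← mul_pow, neg_mul, Complex.I_mul_I, neg_neg, one_pow]
  linear_combination ((Real.cos (d * phase k) * (starRingEnd ℂ) (φ b)
        - Complex.I * Real.sin (d * phase k) * (starRingEnd ℂ) (axisMap k φ b))
      * (Real.cos (d * phase k') * φ b
        + Complex.I * Real.sin (d * phase k') * axisMap k' φ b)) * this

/-- The Bloch vector of `symQubit` is the second coordinate vector, so n·σ has expectation `tilt k`.
The product of n·σ and n'·σ also brings in the cross product n × n', but its second component
vanishes because the first and third components of each axis coincide. -/
theorem overlap_symQubit (d : ℕ) (k k' : ℝ) :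
    overlap d symQubit k k' = overlapReal d k k' + Complex.I * overlapImag d k k' := by
  have hne : ¬ ((-1 : ℤˣ) = 1) := by decide
  have hs : (1 / (Real.sqrt 2 : ℂ)) ^ 2 = 1 / 2 := by
    rw [div_pow, ← Complex.ofReal_pow, Real.sq_sqrt (by norm_num)]; norm_num
  set s : ℂ := 1 / (Real.sqrt 2 : ℂ) with hsd
  have hsc : (starRingEnd ℂ) s = s := by rw [hsd]; simp
  have e1 : symQubit 1 = s := by simp [symQubit, hsd]
  have e2 : symQubit (-1) = Complex.I * s := by simp [symQubit, hne, hsd, div_eq_mul_inv]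
  rw [overlap_eq, sum_units]
  simp only [axisMap, hne, if_true, if_false, e1, e2, map_mul, map_add, map_sub, Complex.conj_I,
    Complex.conj_ofReal, hsc, overlapReal, overlapImag, Complex.ofReal_add, Complex.ofReal_mul,
    Complex.ofReal_sub, Complex.ofReal_ofNat]
  generalize (Real.cos (d * phase k) : ℂ) = C
  generalize (Real.cos (d * phase k') : ℂ) = C'
  generalize (Real.sin (d * phase k) : ℂ) = S
  generalize (Real.sin (d * phase k') : ℂ) = S'
  generalize (velocity k : ℂ) = p
  generalize (velocity k' : ℂ) = p'
  generalize (tilt k : ℂ) = q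
  generalize (tilt k' : ℂ) = q'
  have hI := Complex.I_sq
  have hI4 : Complex.I ^ 4 = 1 := Complex.I_pow_four
  have hI3 : Complex.I ^ 3 = -Complex.I := Complex.I_pow_three
  have hI5 : Complex.I ^ 5 = Complex.I := by rw [pow_succ, hI4, one_mul]
  have hI6 : Complex.I ^ 6 = -1 := by rw [pow_succ, hI5, ← sq, hI]
  ring_nf
  simp only [hs, hI, hI4, hI3]
  ring_nf
  simp only [hI5, hI6]
  ring

/-- The mean over the basis is half a trace, which kills every term linear in the Pauli matrices. -/
theorem half_sum_overlap_single (d : ℕ) (k k' : ℝ) :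
    (1 / 2) * ∑ b : ℤˣ, overlap d (Pi.single b 1) k k' = overlapReal d k k' := by
  have hne : ¬ ((-1 : ℤˣ) = 1) := by decide
  have hne' : ¬ ((1 : ℤˣ) = -1) := by decide
  simp only [overlap_eq, sum_units]
  simp only [axisMap, hne, hne', if_true, if_false, Pi.single_apply, map_mul, map_add, map_sub,
    Complex.conj_I,
    Complex.conj_ofReal, overlapReal, Complex.ofReal_add, Complex.ofReal_mul,
    Complex.ofReal_ofNat, map_one, map_zero]
  generalize (Real.cos (d * phase k) : ℂ) = C
  generalize (Real.cos (d * phase k') : ℂ) = C'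
  generalize (Real.sin (d * phase k) : ℂ) = S
  generalize (Real.sin (d * phase k') : ℂ) = S'
  generalize (velocity k : ℂ) = p
  generalize (velocity k' : ℂ) = p'
  generalize (tilt k : ℂ) = q
  generalize (tilt k' : ℂ) = q'
  have hI := Complex.I_sq
  have hI4 : Complex.I ^ 4 = 1 := Complex.I_pow_four
  ring_nf
  simp only [hI, hI4]
  ring_nf

/-- Cauchy–Schwarz in ℂ², in the form of Lagrange's identity for the unit vectors (C + iqS, √2 pS)
and (C' + iq'S', √2 p'S'). -/
theorem overlap_normSq_le (d : ℕ) (k k' : ℝ) :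
    overlapReal d k k' ^ 2 + overlapImag d k k' ^ 2 ≤ 1 := by
  have key : ∀ C S C' S' p q p' q' : ℝ, C ^ 2 + S ^ 2 = 1 → C' ^ 2 + S' ^ 2 = 1 →
      2 * p ^ 2 + q ^ 2 = 1 → 2 * p' ^ 2 + q' ^ 2 = 1 →
      (C * C' + (q * q' + 2 * p * p') * (S * S')) ^ 2 + (q' * (C * S') - q * (S * C')) ^ 2 ≤ 1 := by
    intro C S C' S' p q p' q' h h' hp hp'
    have n1 : C ^ 2 + q ^ 2 * S ^ 2 + 2 * (p * S) ^ 2 = 1 := by linear_combination h + S ^ 2 * hp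
    have n2 : C' ^ 2 + q' ^ 2 * S' ^ 2 + 2 * (p' * S') ^ 2 = 1 := by
      linear_combination h' + S' ^ 2 * hp'
    have id : (C ^ 2 + q ^ 2 * S ^ 2 + 2 * (p * S) ^ 2)
          * (C' ^ 2 + q' ^ 2 * S' ^ 2 + 2 * (p' * S') ^ 2)
        - ((C * C' + (q * q' + 2 * p * p') * (S * S')) ^ 2 + (q' * (C * S') - q * (S * C')) ^ 2)
        = 2 * ((C * (p' * S') - C' * (p * S)) ^ 2
          + (q * S * (p' * S') - q' * S' * (p * S)) ^ 2) := by ring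
    rw [n1, n2] at id
    nlinarith [sq_nonneg (C * (p' * S') - C' * (p * S)),
      sq_nonneg (q * S * (p' * S') - q' * S' * (p * S))]
  exact key _ _ _ _ _ _ _ _ (Real.cos_sq_add_sin_sq _) (Real.cos_sq_add_sin_sq _)
    (axis_unit k) (axis_unit k')

theorem norm_overlap_le (d : ℕ) (k k' : ℝ) :
    ‖(overlapReal d k k' + Complex.I * overlapImag d k k' : ℂ)‖ ≤ 1 := by
  rw [mul_comm, Complex.norm_add_mul_I]
  exact Real.sqrt_le_one.mpr (overlap_normSq_le d k k')

theorem abs_overlapReal_le (d : ℕ) (k k' : ℝ) : |overlapReal d k k'| ≤ 1 := by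
  rw [← sq_le_one_iff_abs_le_one]
  nlinarith [overlap_normSq_le d k k', sq_nonneg (overlapImag d k k')]

theorem hasDerivAt_phase (k : ℝ) : HasDerivAt phase (velocity k) k := by
  have h := abs_lt.mp (abs_sin_div_sqrt_two_lt k)
  have h1 := (Real.hasDerivAt_arccos h.1.ne' h.2.ne).comp k
    ((Real.hasDerivAt_sin k).div_const (Real.sqrt 2))
  convert! h1 using 1
  have h2 : Real.sqrt (1 - (Real.sin k / Real.sqrt 2) ^ 2)
      = Real.sqrt (1 + Real.cos k ^ 2) / Real.sqrt 2 := by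
    rw [← sin_phase, phase, Real.sin_arccos]
  rw [h2, velocity]
  have := (sqrt_one_add_cos_sq_pos k).ne'
  field_simp

theorem differentiable_velocity : Differentiable ℝ velocity := by
  intro k
  unfold velocity
  have := (sqrt_one_add_cos_sq_pos k).ne'
  have h : 1 + Real.cos k ^ 2 ≠ 0 := by positivity
  fun_prop (disch := assumption)

theorem differentiable_tilt : Differentiable ℝ tilt := by
  intro k
  unfold tilt
  have := (sqrt_one_add_cos_sq_pos k).ne'
  have h : 1 + Real.cos k ^ 2 ≠ 0 := by positivity
  fun_prop (disch := assumption)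


/-! ### Asymptotics of the overlaps and of their powers. -/

/-- m log(1 + g) is m g times the slope of `log` between 1 and 1 + g, and that slope tends to 1
because g tends to 0. -/
theorem tendsto_one_add_pow_exp {ι : Type*} {l : Filter ι} {m : ι → ℕ} {g : ι → ℂ} {t : ℂ}
    (hm : Tendsto m l atTop) (hg : Tendsto (fun n => (m n : ℂ) * g n) l (𝓝 t)) :
    Tendsto (fun n => (1 + g n) ^ m n) l (𝓝 (Complex.exp t)) := by
  have hinv : Tendsto (fun n => ((m n : ℂ))⁻¹) l (𝓝 0) :=
    (tendsto_inv_atTop_nhds_zero_nat (𝕜 := ℂ)).comp hm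
  have h0 : ∀ᶠ n in l, m n ≠ 0 := hm.eventually_ne_atTop 0
  have hg0 : Tendsto g l (𝓝 0) := by
    have := hinv.mul hg
    rw [zero_mul] at this
    refine this.congr' ?_
    filter_upwards [h0] with n hn
    rw [inv_mul_cancel_left₀ (Nat.cast_ne_zero.mpr hn)]
  have hd : HasDerivAt Complex.log 1 1 := by
    simpa using Complex.hasDerivAt_log Complex.one_mem_slitPlane
  have hD : Tendsto (fun n => dslope Complex.log 1 (1 + g n)) l (𝓝 1) := by
    have hc := (continuousAt_dslope_same (f := Complex.log) (a := 1)).mpr hd.differentiableAt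
    have h1 : Tendsto (fun n => 1 + g n) l (𝓝 1) := by simpa using hg0.const_add 1
    have := hc.tendsto.comp h1
    rwa [dslope_same, hd.deriv] at this
  have hlog : Tendsto (fun n => (m n : ℂ) * Complex.log (1 + g n)) l (𝓝 t) := by
    have := hg.mul hD
    rw [mul_one] at this
    refine this.congr fun n => ?_
    have h2 := sub_smul_dslope Complex.log 1 (1 + g n)
    rw [add_sub_cancel_left, Complex.log_one, sub_zero, smul_eq_mul] at h2
    rw [mul_assoc, h2]
  refine ((Complex.continuous_exp.tendsto _).comp hlog).congr' ?_
  have hne : ∀ᶠ n in l, g n ≠ -1 := hg0.eventually_ne (by norm_num)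
  filter_upwards [hne] with n hn
  have : 1 + g n ≠ 0 := fun h => hn (by linear_combination h)
  rw [Function.comp_apply, Complex.exp_nat_mul, Complex.exp_log this]

/-- An exact first-order expansion. At ε = 0 `dslope` takes the value of the derivative, so θ = 0
needs no separate treatment. -/
theorem add_eq_add_mul_dslope (f : ℝ → ℝ) (k ε : ℝ) :
    f (k + ε) = f k + ε * dslope f k (k + ε) := by
  have := sub_smul_dslope f k (k + ε)
  rw [add_sub_cancel_left, smul_eq_mul] at this
  linarith

theorem tendsto_dslope {ι : Type*} {l : Filter ι} {f : ℝ → ℝ} {k f' : ℝ} (hf : HasDerivAt f f' k)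
    {ε : ι → ℝ} (hε : Tendsto ε l (𝓝 0)) :
    Tendsto (fun n => dslope f k (k + ε n)) l (𝓝 f') := by
  have h1 : Tendsto (fun n => k + ε n) l (𝓝 k) := by simpa using hε.const_add k
  have := (continuousAt_dslope_same.mpr hf.differentiableAt).tendsto.comp h1
  rwa [dslope_same, hf.deriv] at this

theorem tendsto_mul_sin {ι : Type*} {l : Filter ι} {m x : ι → ℝ} {c : ℝ} (hx : Tendsto x l (𝓝 0))
    (hmx : Tendsto (fun n => m n * x n) l (𝓝 c)) :
    Tendsto (fun n => m n * Real.sin (x n)) l (𝓝 c) := by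
  have hd : HasDerivAt Real.sin 1 0 := by simpa using Real.hasDerivAt_sin 0
  have := hmx.mul (tendsto_dslope hd hx)
  rw [mul_one] at this
  refine this.congr fun n => ?_
  have h := add_eq_add_mul_dslope Real.sin 0 (x n)
  rw [zero_add, Real.sin_zero, zero_add] at h
  rw [zero_add, mul_assoc, ← h]

theorem tendsto_mul_cos_sub_one {ι : Type*} {l : Filter ι} {m x : ι → ℝ} {c : ℝ}
    (hx : Tendsto x l (𝓝 0)) (hmx : Tendsto (fun n => m n * x n) l (𝓝 c)) :
    Tendsto (fun n => m n * (Real.cos (x n) - 1)) l (𝓝 0) := by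
  have hd : HasDerivAt Real.cos 0 0 := by simpa using Real.hasDerivAt_cos 0
  have := hmx.mul (tendsto_dslope hd hx)
  rw [mul_zero] at this
  refine this.congr fun n => ?_
  have h := add_eq_add_mul_dslope Real.cos 0 (x n)
  rw [zero_add, Real.cos_zero] at h
  rw [zero_add, mul_assoc]
  linear_combination -m n * h

theorem tendsto_mul_cos_sub_one' {ι : Type*} {l : Filter ι} {m x : ι → ℝ} {c : ℝ}
    (hx : Tendsto x l (𝓝 0)) (hmx : Tendsto (fun n => m n * x n ^ 2) l (𝓝 c)) :
    Tendsto (fun n => m n * (Real.cos (x n) - 1)) l (𝓝 (-(c / 2))) := by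
  have hd : HasDerivAt Real.sin 1 0 := by simpa using Real.hasDerivAt_sin 0
  have hx2 : Tendsto (fun n => x n / 2) l (𝓝 0) := by simpa using hx.div_const 2
  have := (hmx.mul ((tendsto_dslope hd hx2).pow 2)).mul_const (-(1 / 2))
  rw [show c * 1 ^ 2 * (-(1 / 2)) = -(c / 2) by ring] at this
  refine this.congr fun n => ?_
  have h := add_eq_add_mul_dslope Real.sin 0 (x n / 2)
  rw [zero_add, Real.sin_zero, zero_add] at h
  have h2 : Real.cos (x n) = 1 - 2 * Real.sin (x n / 2) ^ 2 := by
    have h3 := Real.cos_two_mul (x n / 2)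
    rw [mul_div_cancel₀ _ (two_ne_zero)] at h3
    linear_combination h3 + 2 * Real.sin_sq_add_cos_sq (x n / 2)
  rw [zero_add, h2, h]
  ring

/-- A unit vector is orthogonal to its derivative: this is `axis_unit` differentiated. It removes
the first-order effect of the turning axis on the real overlap. -/
theorem velocity_mul_deriv (k : ℝ) :
    tilt k * deriv tilt k + 2 * velocity k * deriv velocity k = 0 := by
  have h1 := (((differentiable_velocity k).hasDerivAt.pow 2).const_mul 2).add
    ((differentiable_tilt k).hasDerivAt.pow 2)
  have h2 : (fun k => 2 * velocity k ^ 2 + tilt k ^ 2) = fun _ => (1 : ℝ) := funext axis_unit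
  have h3 := h1.deriv
  have h4 : deriv (fun k => 2 * velocity k ^ 2 + tilt k ^ 2) k = 0 := by rw [h2]; simp
  have h5 : deriv (fun k => 2 * velocity k ^ 2 + tilt k ^ 2) k
    = 2 * (((2 : ℕ) : ℝ) * velocity k ^ (2 - 1) * deriv velocity k)
      + ((2 : ℕ) : ℝ) * tilt k ^ (2 - 1) * deriv tilt k := h3
  rw [h4] at h5
  norm_num at h5
  linarith

/-- Separates the change of the rotation angle, amplified by `d`, from the change of the axis, which
only meets bounded factors. -/
theorem overlapReal_eq (d : ℕ) (k k' : ℝ) :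
    overlapReal d k k' = Real.cos (d * (phase k' - phase k))
      + (tilt k * (tilt k' - tilt k) + 2 * velocity k * (velocity k' - velocity k))
        * (Real.sin (d * phase k) * Real.sin (d * phase k')) := by
  rw [overlapReal, mul_sub, Real.cos_sub]
  linear_combination (Real.sin (d * phase k) * Real.sin (d * phase k')) * axis_unit k

theorem overlapImag_eq (d : ℕ) (k k' : ℝ) :
    overlapImag d k k' = tilt k * Real.sin (d * (phase k' - phase k))
      + (tilt k' - tilt k) * (Real.cos (d * phase k) * Real.sin (d * phase k')) := by
  rw [overlapImag, mul_sub, Real.sin_sub]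
  ring

theorem abs_mul_sin_le {u v : ℝ} (hu : |u| ≤ 1) (hv : |v| ≤ 1) : |u * v| ≤ 1 := by
  rw [abs_mul]; exact mul_le_one₀ hu (abs_nonneg _) hv

theorem tendsto_mul_bounded {ι : Type*} {l : Filter ι} {u v : ι → ℝ} (hu : Tendsto u l (𝓝 0))
    (hv : ∀ n, |v n| ≤ 1) : Tendsto (fun n => u n * v n) l (𝓝 0) := by
  refine squeeze_zero_norm (fun n => ?_) (tendsto_zero_iff_norm_tendsto_zero.mp hu)
  rw [norm_mul]
  exact mul_le_of_le_one_right (norm_nonneg _) (hv n)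

section Limits

variable {ι : Type*} {l : Filter ι} {d M : ι → ℕ} {ε : ι → ℝ} {k θ η : ℝ}

theorem tendsto_smul_increment {f : ℝ → ℝ} {f' : ℝ} {c : ι → ℝ} (hf : HasDerivAt f f' k)
    (hε : Tendsto ε l (𝓝 0)) (hc : Tendsto (fun n => c n * ε n) l (𝓝 θ)) :
    Tendsto (fun n => c n * (f (k + ε n) - f k)) l (𝓝 (θ * f')) := by
  refine (hc.mul (tendsto_dslope hf hε)).congr fun n => ?_
  rw [add_eq_add_mul_dslope f k (ε n)]
  ring

theorem tendsto_axis_increment {c : ι → ℝ}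
    (hε : Tendsto ε l (𝓝 0)) (hc : Tendsto (fun n => c n * ε n) l (𝓝 θ)) :
    Tendsto (fun n => c n * (tilt k * (tilt (k + ε n) - tilt k)
      + 2 * velocity k * (velocity (k + ε n) - velocity k))) l (𝓝 0) := by
  have h1 := (tendsto_smul_increment (differentiable_tilt k).hasDerivAt hε hc).const_mul (tilt k)
  have h2 := (tendsto_smul_increment (differentiable_velocity k).hasDerivAt hε hc).const_mul
    (2 * velocity k)
  have := h1.add h2
  rw [show tilt k * (θ * deriv tilt k) + 2 * velocity k * (θ * deriv velocity k) = 0 by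
    linear_combination θ * velocity_mul_deriv k] at this
  exact this.congr fun n => by ring

theorem tendsto_overlapReal (hε : Tendsto ε l (𝓝 0))
    (hd : Tendsto (fun n => (d n : ℝ) * ε n) l (𝓝 θ)) :
    Tendsto (fun n => overlapReal (d n) k (k + ε n)) l (𝓝 (Real.cos (velocity k * θ))) := by
  simp only [overlapReal_eq]
  have h1 := tendsto_smul_increment (hasDerivAt_phase k) hε hd
  have h2 : Tendsto (fun n => tilt k * (tilt (k + ε n) - tilt k)
      + 2 * velocity k * (velocity (k + ε n) - velocity k)) l (𝓝 0) := by
    simpa using tendsto_axis_increment (k := k) (c := fun _ => 1) hε (by simpa using hε)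
  have := ((Real.continuous_cos.tendsto _).comp h1).add (tendsto_mul_bounded h2
    (v := fun n => Real.sin (d n * phase k) * Real.sin (d n * phase (k + ε n)))
    fun n => abs_mul_sin_le (Real.abs_sin_le_one _) (Real.abs_sin_le_one _))
  rw [add_zero, mul_comm θ] at this
  exact this

theorem tendsto_overlapImag (hε : Tendsto ε l (𝓝 0))
    (hd : Tendsto (fun n => (d n : ℝ) * ε n) l (𝓝 θ)) :
    Tendsto (fun n => overlapImag (d n) k (k + ε n)) l
      (𝓝 (tilt k * Real.sin (velocity k * θ))) := by
  simp only [overlapImag_eq]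
  have h1 := tendsto_smul_increment (hasDerivAt_phase k) hε hd
  have h2 : Tendsto (fun n => tilt (k + ε n) - tilt k) l (𝓝 0) := by
    have := tendsto_smul_increment (c := fun _ => 1) (θ := 0) (differentiable_tilt k).hasDerivAt hε
      (by simpa using hε)
    simpa only [one_mul, zero_mul] using this
  have := (((Real.continuous_sin.tendsto _).comp h1).const_mul (tilt k)).add
    (tendsto_mul_bounded h2
    (v := fun n => Real.cos (d n * phase k) * Real.sin (d n * phase (k + ε n)))
    fun n => abs_mul_sin_le (Real.abs_cos_le_one _) (Real.abs_sin_le_one _))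
  rw [add_zero, mul_comm θ] at this
  exact this

/-- The angle enters through cos - 1, which is of second order, and the axis increment has no
first-order part along the axis; so multiplication by `m` ~ 1/(dε) leaves nothing. -/
theorem tendsto_smul_overlapReal_sub_one {m : ι → ℝ}
    (hε : Tendsto ε l (𝓝 0)) (hd0 : Tendsto (fun n => (d n : ℝ) * ε n) l (𝓝 0))
    (hm : Tendsto (fun n => m n * ε n) l (𝓝 η))
    (hd : Tendsto (fun n => m n * d n * ε n) l (𝓝 θ)) :
    Tendsto (fun n => m n * (overlapReal (d n) k (k + ε n) - 1)) l (𝓝 0) := by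
  simp only [overlapReal_eq]
  have h0 := tendsto_smul_increment (hasDerivAt_phase k) hε hd0
  rw [zero_mul] at h0
  have h1 := tendsto_smul_increment (hasDerivAt_phase k) hε hd
  have h2 := tendsto_mul_cos_sub_one h0 (h1.congr fun n => mul_assoc _ _ _)
  have h3 := tendsto_axis_increment (k := k) hε hm
  have := h2.add (tendsto_mul_bounded h3
    (v := fun n => Real.sin (d n * phase k) * Real.sin (d n * phase (k + ε n)))
    fun n => abs_mul_sin_le (Real.abs_sin_le_one _) (Real.abs_sin_le_one _))
  rw [add_zero] at this
  exact this.congr fun n => by ring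

/-- The angle contributes the drift term. The change of `tilt` contributes `c`, which is 0 when d →
∞ but survives for fixed `d`. -/
theorem tendsto_smul_overlapImag {m : ι → ℝ} {c : ℝ}
    (hε : Tendsto ε l (𝓝 0)) (hd0 : Tendsto (fun n => (d n : ℝ) * ε n) l (𝓝 0))
    (hd : Tendsto (fun n => m n * d n * ε n) l (𝓝 θ))
    (hc : Tendsto (fun n => m n * (tilt (k + ε n) - tilt k)
      * (Real.cos (d n * phase k) * Real.sin (d n * phase (k + ε n)))) l (𝓝 c)) :
    Tendsto (fun n => m n * overlapImag (d n) k (k + ε n)) l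
      (𝓝 (θ * (velocity k * tilt k) + c)) := by
  simp only [overlapImag_eq]
  have h0 := tendsto_smul_increment (hasDerivAt_phase k) hε hd0
  rw [zero_mul] at h0
  have h1 := tendsto_smul_increment (hasDerivAt_phase k) hε hd
  have h2 := (tendsto_mul_sin h0 (h1.congr fun n => mul_assoc _ _ _)).const_mul (tilt k)
  have := h2.add hc
  rw [show tilt k * (θ * velocity k) = θ * (velocity k * tilt k) by ring] at this
  exact this.congr fun n => by ring

theorem tendsto_pow_exp_mul_I {R J : ι → ℝ} {c : ℝ} (hM : Tendsto M l atTop)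
    (hR : Tendsto (fun n => (M n : ℝ) * (R n - 1)) l (𝓝 0))
    (hJ : Tendsto (fun n => (M n : ℝ) * J n) l (𝓝 c)) :
    Tendsto (fun n => ((R n : ℂ) + Complex.I * J n) ^ M n) l (𝓝 (Complex.exp (c * Complex.I))) := by
  have h1 := ((Complex.continuous_ofReal.tendsto _).comp hR).add
    (((Complex.continuous_ofReal.tendsto _).comp hJ).const_mul Complex.I)
  have h2 : Tendsto (fun n => (M n : ℂ) * ((R n : ℂ) - 1 + Complex.I * J n)) l
      (𝓝 (c * Complex.I)) := by
    rw [Complex.ofReal_zero, zero_add, mul_comm] at h1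
    refine h1.congr fun n => ?_
    simp only [Function.comp_apply]
    push_cast
    ring
  exact (tendsto_one_add_pow_exp hM h2).congr fun n => by ring_nf

theorem tendsto_pow_exp_real {R : ι → ℝ} {c : ℝ} (hM : Tendsto M l atTop)
    (hR : Tendsto (fun n => (M n : ℝ) * (R n - 1)) l (𝓝 c)) :
    Tendsto (fun n => (R n : ℂ) ^ M n) l (𝓝 (Complex.exp c)) := by
  have h1 := (Complex.continuous_ofReal.tendsto _).comp hR
  have h2 : Tendsto (fun n => (M n : ℂ) * ((R n : ℂ) - 1)) l (𝓝 c) := by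
    refine h1.congr fun n => ?_
    simp
  exact (tendsto_one_add_pow_exp hM h2).congr fun n => by ring_nf

end Limits

/-- The squared speed of the rotation reached after `d` steps. -/
def speedSq (d : ℕ) (k : ℝ) : ℝ :=
  (d * velocity k * Real.sin (d * phase k)) ^ 2
    + (deriv tilt k * Real.sin (d * phase k)
        + tilt k * (Real.cos (d * phase k) * (d * velocity k))) ^ 2
    + 2 * (deriv velocity k * Real.sin (d * phase k)
        + velocity k * (Real.cos (d * phase k) * (d * velocity k))) ^ 2

/-- Pythagoras: the motions of the angle and of the axis are orthogonal. Only the first grows with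
`d`, so `speedSq d k / d²` tends to the squared velocity. -/
theorem speedSq_eq (d : ℕ) (k : ℝ) :
    speedSq d k = d ^ 2 * velocity k ^ 2
      + (deriv tilt k ^ 2 + 2 * deriv velocity k ^ 2) * Real.sin (d * phase k) ^ 2 := by
  rw [speedSq]
  linear_combination
    (2 * Real.sin (d * phase k) * Real.cos (d * phase k) * d * velocity k)
      * velocity_mul_deriv k
    + (Real.cos (d * phase k) ^ 2 * d ^ 2 * velocity k ^ 2) * axis_unit k
    + d ^ 2 * velocity k ^ 2 * Real.sin_sq_add_cos_sq (d * phase k)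

/-- For unit vectors of ℝ⁴, one minus the inner product is half the squared distance. -/
theorem overlapReal_sub_one (d : ℕ) (k k' : ℝ) :
    overlapReal d k k' - 1 = -(1 / 2)
      * ((Real.cos (d * phase k') - Real.cos (d * phase k)) ^ 2
        + (tilt k' * Real.sin (d * phase k') - tilt k * Real.sin (d * phase k)) ^ 2
        + 2 * (velocity k' * Real.sin (d * phase k')
          - velocity k * Real.sin (d * phase k)) ^ 2) := by
  rw [overlapReal]
  linear_combination (1 / 2) * Real.sin_sq_add_cos_sq (d * phase k)
    + (1 / 2) * Real.sin_sq_add_cos_sq (d * phase k')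
    + (1 / 2) * Real.sin (d * phase k) ^ 2 * axis_unit k
    + (1 / 2) * Real.sin (d * phase k') ^ 2 * axis_unit k'

/-- Serves the scale ε ~ M^(-1/2), where the second order counts. The squared distance yields it
from first difference quotients alone. -/
theorem tendsto_smul_overlapReal_sub_one_sq {ι : Type*} {l : Filter ι} {m ε : ι → ℝ} {η : ℝ}
    (d : ℕ) (k : ℝ) (hε : Tendsto ε l (𝓝 0)) (hm : Tendsto (fun n => m n * ε n ^ 2) l (𝓝 η)) :
    Tendsto (fun n => m n * (overlapReal d k (k + ε n) - 1)) l
      (𝓝 (-(1 / 2) * (η * speedSq d k))) := by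
  have hs : HasDerivAt (fun k => (d : ℝ) * phase k) (d * velocity k) k :=
    (hasDerivAt_phase k).const_mul _
  have e1 := tendsto_dslope hs.cos hε
  have e2 := tendsto_dslope ((differentiable_tilt k).hasDerivAt.mul hs.sin) hε
  have e3 := tendsto_dslope ((differentiable_velocity k).hasDerivAt.mul hs.sin) hε
  have := (hm.mul (((e1.pow 2).add (e2.pow 2)).add ((e3.pow 2).const_mul 2))).const_mul (-(1 / 2))
  have e : (-Real.sin (d * phase k) * (d * velocity k)) ^ 2
      + (deriv tilt k * Real.sin (d * phase k)
        + tilt k * (Real.cos (d * phase k) * (d * velocity k))) ^ 2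
      + 2 * (deriv velocity k * Real.sin (d * phase k)
        + velocity k * (Real.cos (d * phase k) * (d * velocity k))) ^ 2 = speedSq d k := by
    rw [speedSq]; ring
  rw [e] at this
  refine this.congr fun n => ?_
  rw [overlapReal_sub_one]
  have i1 := add_eq_add_mul_dslope (fun k => Real.cos (d * phase k)) k (ε n)
  have i2 := add_eq_add_mul_dslope (tilt * fun k => Real.sin (d * phase k)) k (ε n)
  have i3 := add_eq_add_mul_dslope (velocity * fun k => Real.sin (d * phase k)) k (ε n)
  simp only [Pi.mul_apply] at i1 i2 i3
  rw [i1, i2, i3]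
  ring

/-! ### Weak convergence from averages over the wave number. -/

/-- A variant of Lévy's continuity theorem in which the limit is not given. -/
theorem exists_tendsto_of_tendsto_charFun {μ : ℕ → ProbabilityMeasure ℝ} {f : ℝ → ℂ}
    (hf : ContinuousAt f 0)
    (h : ∀ t, Tendsto (fun n => charFun (μ n : Measure ℝ) t) atTop (𝓝 (f t))) :
    ∃ ν : ProbabilityMeasure ℝ, Tendsto μ atTop (𝓝 ν) ∧ ∀ t, charFun (ν : Measure ℝ) t = f t := by
  have ht := isTightMeasureSet_of_tendsto_charFun (μ := fun n => (μ n : Measure ℝ)) hf h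
  have hK : IsCompact (closure (Set.range μ)) :=
    isCompact_closure_of_isTightMeasureSet (by
      convert ht using 1
      ext ρ
      simp)
  -- Tightness gives a limit along a free ultrafilter. Its characteristic function must be `f`, and
  -- this candidate then attracts the whole sequence.
  obtain ⟨ν, -, hν⟩ := hK.ultrafilter_le_nhds ((hyperfilter ℕ).map μ)
    (by
      refine le_trans ?_ (monotone_principal subset_closure)
      simp)
  have hν' : Tendsto μ (hyperfilter ℕ : Filter ℕ) (𝓝 ν) := hν
  have hchar : ∀ t, charFun (ν : Measure ℝ) t = f t := by
    intro t
    refine tendsto_nhds_unique ?_ ((h t).mono_left Nat.hyperfilter_le_atTop)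
    rw [ProbabilityMeasure.tendsto_iff_forall_integral_rclike_tendsto ℂ] at hν'
    simp_rw [charFun_eq_integral_innerProbChar]
    exact hν' _
  refine ⟨ν, ProbabilityMeasure.tendsto_of_tendsto_charFun fun t => ?_, hchar⟩
  rw [hchar]
  exact h t

theorem tendsto_integral_waveLaw (a : ℝ) {F : ℕ → ℝ → ℂ} {f : ℝ → ℂ}
    (hm : ∀ n, AEStronglyMeasurable (F n) (waveLaw a)) (hb : ∀ n k, ‖F n k‖ ≤ 1)
    (hl : ∀ k, Tendsto (fun n => F n k) atTop (𝓝 (f k))) :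
    Tendsto (fun n => ∫ k, F n k ∂(waveLaw a)) atTop (𝓝 (∫ k, f k ∂(waveLaw a))) :=
  tendsto_integral_filter_of_dominated_convergence (fun _ => 1) (Eventually.of_forall hm)
    (Eventually.of_forall fun n => ae_of_all _ (hb n)) (integrable_const _) (ae_of_all _ hl)

/-- If the characteristic functions are averages over the wave number of functions that converge
pointwise, then the laws converge weakly. -/
theorem exists_tendsto_of_tendsto_average (a : ℝ) {μ : ℕ → ProbabilityMeasure ℝ}
    {F : ℕ → ℝ → ℝ → ℂ} {f : ℝ → ℝ → ℂ}
    (hF : ∀ᶠ n in atTop, ∀ θ, charFun (μ n : Measure ℝ) θ = ∫ k, F n θ k ∂(waveLaw a))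
    (hm : ∀ n θ, Continuous (F n θ)) (hb : ∀ n θ k, ‖F n θ k‖ ≤ 1)
    (hl : ∀ θ k, Tendsto (fun n => F n θ k) atTop (𝓝 (f θ k)))
    (hc : ∀ k, ContinuousAt (fun θ => f θ k) 0) :
    ∃ ν : ProbabilityMeasure ℝ, Tendsto μ atTop (𝓝 ν) ∧
      (∀ θ, charFun (ν : Measure ℝ) θ = ∫ k, f θ k ∂(waveLaw a)) ∧
      (∀ θ k, ‖f θ k‖ ≤ 1) ∧ ∀ θ, AEStronglyMeasurable (f θ) (waveLaw a) := by
  have hfb : ∀ θ k, ‖f θ k‖ ≤ 1 := fun θ k =>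
    le_of_tendsto (hl θ k).norm (Eventually.of_forall fun n => hb n θ k)
  have hfm : ∀ θ, AEStronglyMeasurable (f θ) (waveLaw a) := fun θ =>
    aestronglyMeasurable_of_tendsto_ae atTop (fun n => (hm n θ).aestronglyMeasurable)
      (ae_of_all _ (hl θ))
  have hcont : ContinuousAt (fun θ => ∫ k, f θ k ∂(waveLaw a)) 0 :=
    tendsto_integral_filter_of_dominated_convergence (fun _ => 1)
      (Eventually.of_forall hfm) (Eventually.of_forall fun θ => ae_of_all _ (hfb θ))
      (integrable_const _) (ae_of_all _ hc)
  obtain ⟨ν, h1, h2⟩ := exists_tendsto_of_tendsto_charFun (μ := μ) hcont fun θ => by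
    refine (tendsto_integral_waveLaw a (fun n => (hm n θ).aestronglyMeasurable)
      (fun n => hb n θ) (hl θ)).congr' ?_
    filter_upwards [hF] with n hn
    exact (hn θ).symm
  exact ⟨ν, h1, h2, hfb, hfm⟩

/-- The version for a known limit. The bounds are asked only eventually, since the families Z^[M],
Z_d, Y^[M], Y_d carry information only from index 1 or 2 on. -/
theorem tendsto_of_tendsto_average (a : ℝ) {μ : ℕ → ProbabilityMeasure ℝ}
    {ν : ProbabilityMeasure ℝ} {F : ℕ → ℝ → ℝ → ℂ} {f : ℝ → ℝ → ℂ}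
    (hF : ∀ᶠ n in atTop, (∀ θ, charFun (μ n : Measure ℝ) θ = ∫ k, F n θ k ∂(waveLaw a)) ∧
      (∀ θ k, ‖F n θ k‖ ≤ 1) ∧ ∀ θ, AEStronglyMeasurable (F n θ) (waveLaw a))
    (hl : ∀ θ k, Tendsto (fun n => F n θ k) atTop (𝓝 (f θ k)))
    (hν : ∀ θ, charFun (ν : Measure ℝ) θ = ∫ k, f θ k ∂(waveLaw a)) :
    Tendsto μ atTop (𝓝 ν) := by
  refine ProbabilityMeasure.tendsto_of_tendsto_charFun fun θ => ?_
  rw [hν]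
  have := tendsto_integral_filter_of_dominated_convergence (μ := waveLaw a) (l := atTop)
    (F := fun n => F n θ) (f := f θ) (fun _ => 1)
    (hF.mono fun n hn => hn.2.2 θ) (hF.mono fun n hn => ae_of_all _ (hn.2.1 θ))
    (integrable_const _) (ae_of_all _ (hl θ))
  refine this.congr' ?_
  filter_upwards [hF] with n hn
  exact (hn.1 θ).symm


/-! ### Push-forward of Lebesgue measure under piecewise monotone maps. -/

/-- A change of variables on an interval where the map is injective. -/
theorem map_restrict_eq_withDensity {s T : Set ℝ} {h h' G : ℝ → ℝ} (hs : MeasurableSet s)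
    (hm : Measurable h) (hd : ∀ u ∈ s, HasDerivAt h (h' u) u) (hi : Set.InjOn h s)
    (hT : h '' s = T) (hG : ∀ u ∈ s, |h' u| * G (h u) = 1) :
    (volume.restrict s).map h = (volume.restrict T).withDensity fun x => ENNReal.ofReal (G x) := by
  ext B hB
  have key := lintegral_image_eq_lintegral_abs_deriv_mul hs
    (fun u hu => (hd u hu).hasDerivWithinAt) hi (B.indicator fun x => ENNReal.ofReal (G x))
  rw [hT, lintegral_indicator hB] at key
  rw [Measure.map_apply hm hB, withDensity_apply _ hB, key, ← lintegral_indicator_one (hm hB)]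
  refine setLIntegral_congr_fun hs fun u hu => ?_
  by_cases hu2 : h u ∈ B
  · have h2 : u ∈ h ⁻¹' B := hu2
    rw [Set.indicator_of_mem h2, Set.indicator_of_mem hu2, ← ENNReal.ofReal_mul (abs_nonneg _),
      hG u hu, ENNReal.ofReal_one, Pi.one_apply]
  · have h2 : u ∉ h ⁻¹' B := hu2
    rw [Set.indicator_of_notMem h2, Set.indicator_of_notMem hu2, mul_zero]

theorem restrict_Ioc_eq_add {a b c : ℝ} (hab : a ≤ b) (hbc : b ≤ c) :
    (volume.restrict (Set.Ioc a c) : Measure ℝ)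
      = volume.restrict (Set.Ioo a b) + volume.restrict (Set.Ioo b c) := by
  rw [← Set.Ioc_union_Ioc_eq_Ioc hab hbc, Measure.restrict_union
    (Set.Ioc_disjoint_Ioc_of_le le_rfl) measurableSet_Ioc,
    Measure.restrict_congr_set Ioo_ae_eq_Ioc.symm, Measure.restrict_congr_set Ioo_ae_eq_Ioc.symm]

theorem map_restrict_Ioc_of_periodic {h : ℝ → ℝ} {c : ℝ} (hm : Measurable h)
    (hp : Function.Periodic h c) (a b : ℝ) :
    ((volume.restrict (Set.Ioc (a + c) (b + c))).map h : Measure ℝ)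
      = (volume.restrict (Set.Ioc a b)).map h := by
  have h1 : MeasurePreserving (fun x : ℝ => x + c) (volume.restrict (Set.Ioc a b))
      (volume.restrict (Set.Ioc (a + c) (b + c))) := by
    have := (measurePreserving_add_right (volume : Measure ℝ) c).restrict_preimage
      (s := Set.Ioc (a + c) (b + c)) measurableSet_Ioc
    simpa using this
  rw [← h1.map_eq, Measure.map_map hm h1.measurable]
  congr 1
  ext x
  exact hp x

/-! ### The law of the velocity. -/

theorem hasDerivAt_velocity (k : ℝ) :
    HasDerivAt velocity (Real.sin k / Real.sqrt (1 + Real.cos k ^ 2) ^ 3) k := by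
  have hw := (sqrt_one_add_cos_sq_pos k).ne'
  have h1 : HasDerivAt (fun k => 1 + Real.cos k ^ 2)
      (((2 : ℕ) : ℝ) * Real.cos k ^ (2 - 1) * -Real.sin k) k :=
    ((Real.hasDerivAt_cos k).pow 2).const_add 1
  have h2 := (Real.hasDerivAt_cos k).neg.div (h1.sqrt (by positivity)) hw
  refine h2.congr_deriv ?_
  have e : Real.sqrt (1 + Real.cos k ^ 2) ^ 2 = 1 + Real.cos k ^ 2 := Real.sq_sqrt (by positivity)
  simp only [Pi.neg_apply]
  field_simp
  rw [e, Nat.cast_ofNat, show 2 - 1 = 1 from rfl, pow_one]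
  ring

theorem one_sub_velocity_sq (k : ℝ) :
    1 - velocity k ^ 2 = 1 / Real.sqrt (1 + Real.cos k ^ 2) ^ 2 := by
  have hw := (sqrt_one_add_cos_sq_pos k).ne'
  have e : Real.sqrt (1 + Real.cos k ^ 2) ^ 2 = 1 + Real.cos k ^ 2 := Real.sq_sqrt (by positivity)
  rw [velocity]
  field_simp
  rw [e]
  ring

theorem sqrt_one_sub_two_velocity_sq (k : ℝ) :
    Real.sqrt (1 - 2 * velocity k ^ 2) = |Real.sin k| / Real.sqrt (1 + Real.cos k ^ 2) := by
  have : 1 - 2 * velocity k ^ 2 = tilt k ^ 2 := by linear_combination -axis_unit k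
  rw [this, Real.sqrt_sq_eq_abs, tilt, abs_div, abs_of_pos (sqrt_one_add_cos_sq_pos k)]

/-- In terms of `k`, 1 - v² is 1/(1 + cos² k) and √(1 - 2v²) is |sin k|/√(1 + cos² k), so their
product is exactly the Jacobian. -/
theorem velocity_branch_density {k : ℝ} (hk : Real.sin k ≠ 0) :
    |Real.sin k / Real.sqrt (1 + Real.cos k ^ 2) ^ 3|
      * (1 / ((1 - velocity k ^ 2) * Real.sqrt (1 - 2 * velocity k ^ 2))) = 1 := by
  have hw := sqrt_one_add_cos_sq_pos k
  have hs : |Real.sin k| ≠ 0 := abs_ne_zero.mpr hk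
  rw [one_sub_velocity_sq, sqrt_one_sub_two_velocity_sq, abs_div, abs_of_pos (pow_pos hw 3)]
  field_simp

theorem velocity_zero : velocity 0 = -(1 / Real.sqrt 2) := by
  simp [velocity]; norm_num; ring

theorem velocity_pi : velocity Real.pi = 1 / Real.sqrt 2 := by
  simp [velocity]; norm_num

theorem velocity_neg (k : ℝ) : velocity (-k) = velocity k := by simp [velocity]

theorem continuous_velocity : Continuous velocity := differentiable_velocity.continuous

theorem continuous_tilt : Continuous tilt := differentiable_tilt.continuous

theorem strictMonoOn_velocity : StrictMonoOn velocity (Set.Icc 0 Real.pi) := by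
  refine strictMonoOn_of_deriv_pos (convex_Icc _ _) continuous_velocity.continuousOn fun k hk => ?_
  rw [interior_Icc] at hk
  rw [(hasDerivAt_velocity k).deriv]
  exact div_pos (Real.sin_pos_of_pos_of_lt_pi hk.1 hk.2) (pow_pos (sqrt_one_add_cos_sq_pos k) 3)

theorem strictAntiOn_velocity : StrictAntiOn velocity (Set.Icc (-Real.pi) 0) := by
  intro x hx y hy hxy
  rw [← velocity_neg x, ← velocity_neg y]
  exact strictMonoOn_velocity ⟨by linarith [hy.2], by linarith [hy.1]⟩
    ⟨by linarith [hx.2], by linarith [hx.1]⟩ (by linarith)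

/-- `velocity` sweeps the whole interval once on (-π, 0) and once on (0, π), with equal densities;
the factor 2/(2π) gives the 1/π of the Konno density. -/
theorem map_velocity_waveLaw : (waveLaw (-Real.pi)).map velocity = konnoLaw := by
  have hpi := Real.pi_pos
  have hm : Measurable velocity := continuous_velocity.measurable
  have h1 := map_restrict_eq_withDensity (s := Set.Ioo 0 Real.pi)
    (G := fun x => 1 / ((1 - x ^ 2) * Real.sqrt (1 - 2 * x ^ 2))) measurableSet_Ioo hm
    (fun u _ => hasDerivAt_velocity u) (strictMonoOn_velocity.mono Set.Ioo_subset_Icc_self).injOn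
    (ContinuousOn.image_Ioo_of_strictMonoOn hpi.le continuous_velocity.continuousOn
      strictMonoOn_velocity)
    (fun u hu => velocity_branch_density (Real.sin_pos_of_pos_of_lt_pi hu.1 hu.2).ne')
  have h2 := map_restrict_eq_withDensity (s := Set.Ioo (-Real.pi) 0)
    (G := fun x => 1 / ((1 - x ^ 2) * Real.sqrt (1 - 2 * x ^ 2))) measurableSet_Ioo hm
    (fun u _ => hasDerivAt_velocity u) (strictAntiOn_velocity.mono Set.Ioo_subset_Icc_self).injOn
    (ContinuousOn.image_Ioo_of_strictAntiOn (by linarith) continuous_velocity.continuousOn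
      strictAntiOn_velocity)
    (fun u hu => velocity_branch_density (Real.sin_neg_of_neg_of_neg_pi_lt hu.2 hu.1).ne)
  rw [velocity_neg] at h2
  rw [velocity_zero, velocity_pi] at h1 h2
  have hmG : Measurable fun x : ℝ => ENNReal.ofReal (1 / ((1 - x ^ 2) * Real.sqrt (1 - 2 * x ^ 2))) := by
    fun_prop
  rw [waveLaw, Measure.map_smul, restrict_Ioc_eq_add (b := 0) (by linarith) (by linarith),
    show -Real.pi + 2 * Real.pi = Real.pi by ring, Measure.map_add _ _ hm, h1, h2,
    ← withDensity_add_left hmG, ← withDensity_smul _ (hmG.add hmG), konnoLaw]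
  have h3 : (fun x => ENNReal.ofReal (konnoDensity x))
      = (Set.Ioo (-(1 / Real.sqrt 2)) (1 / Real.sqrt 2)).indicator fun x =>
        ENNReal.ofReal (1 / (Real.pi * (1 - x ^ 2) * Real.sqrt (1 - 2 * x ^ 2))) := by
    ext x
    unfold konnoDensity
    by_cases hx : x ∈ Set.Ioo (-(1 / Real.sqrt 2)) (1 / Real.sqrt 2)
    · rw [Set.indicator_of_mem hx, Set.indicator_of_mem hx]
    · rw [Set.indicator_of_notMem hx, Set.indicator_of_notMem hx, ENNReal.ofReal_zero]
  rw [h3, withDensity_indicator measurableSet_Ioo]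
  refine withDensity_congr_ae (ae_restrict_of_forall_mem measurableSet_Ioo fun x hx => ?_)
  have hx2 : x ^ 2 < 1 / 2 := by
    have := sq_lt_sq' hx.1 hx.2
    rwa [div_pow, one_pow, Real.sq_sqrt (by norm_num)] at this
  have h4 : 0 ≤ 1 / ((1 - x ^ 2) * Real.sqrt (1 - 2 * x ^ 2)) :=
    one_div_nonneg.mpr (mul_nonneg (by linarith) (Real.sqrt_nonneg _))
  simp only [Pi.smul_apply, Pi.add_apply, smul_eq_mul]
  rw [← ENNReal.ofReal_add h4 h4, ← ENNReal.ofReal_mul (by positivity)]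
  congr 1
  field_simp
  norm_num

/-! ### The law of the drift. -/

/-- The limit in Case (A) as a function of the wave number. -/
def drift (k : ℝ) : ℝ := velocity k * tilt k

theorem drift_eq (k : ℝ) : drift k = -(Real.cos k * Real.sin k) / (1 + Real.cos k ^ 2) := by
  have hw := (sqrt_one_add_cos_sq_pos k).ne'
  have e : Real.sqrt (1 + Real.cos k ^ 2) ^ 2 = 1 + Real.cos k ^ 2 := Real.sq_sqrt (by positivity)
  have : 1 + Real.cos k ^ 2 ≠ 0 := by positivity
  rw [drift, velocity, tilt, div_mul_div_comm, ← sq, e, neg_mul]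

theorem continuous_drift : Continuous drift := continuous_velocity.mul continuous_tilt

theorem drift_periodic : Function.Periodic drift Real.pi := by
  intro k
  simp [drift_eq]

theorem hasDerivAt_drift (k : ℝ) :
    HasDerivAt drift ((1 - 3 * Real.cos k ^ 2) / (1 + Real.cos k ^ 2) ^ 2) k := by
  have hw : 1 + Real.cos k ^ 2 ≠ 0 := by positivity
  have h1 : HasDerivAt (fun k => 1 + Real.cos k ^ 2)
      (((2 : ℕ) : ℝ) * Real.cos k ^ (2 - 1) * -Real.sin k) k :=
    ((Real.hasDerivAt_cos k).pow 2).const_add 1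
  have h2 := ((Real.hasDerivAt_cos k).mul (Real.hasDerivAt_sin k)).neg.div h1 hw
  have h3 : drift = (-(Real.cos * Real.sin)) / fun k => 1 + Real.cos k ^ 2 :=
    funext fun k => by simp [drift_eq]
  rw [h3]
  refine h2.congr_deriv ?_
  congr 1
  simp only [Pi.neg_apply, Pi.mul_apply]
  norm_num
  linear_combination (1 - Real.cos k ^ 2) * Real.sin_sq_add_cos_sq k

theorem one_add_drift_sq (k : ℝ) :
    1 + drift k ^ 2 = (1 + 3 * Real.cos k ^ 2) / (1 + Real.cos k ^ 2) ^ 2 := by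
  have hw : 1 + Real.cos k ^ 2 ≠ 0 := by positivity
  rw [drift_eq]
  field_simp
  linear_combination Real.cos k ^ 2 * Real.sin_sq_add_cos_sq k

theorem sqrt_one_sub_eight_drift_sq (k : ℝ) :
    Real.sqrt (1 - 8 * drift k ^ 2) = |1 - 3 * Real.cos k ^ 2| / (1 + Real.cos k ^ 2) := by
  have hw : 0 < 1 + Real.cos k ^ 2 := by positivity
  have : 1 - 8 * drift k ^ 2 = ((1 - 3 * Real.cos k ^ 2) / (1 + Real.cos k ^ 2)) ^ 2 := by
    rw [drift_eq]
    field_simp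
    linear_combination -(8 * Real.cos k ^ 2) * Real.sin_sq_add_cos_sq k
  rw [this, Real.sqrt_sq_eq_abs, abs_div, abs_of_pos hw]

/-- The contribution of one monotonicity interval of `drift`, `σ = 1` or `σ = -1`, to the limit
density. -/
def driftDensity (σ x : ℝ) : ℝ :=
  (3 + σ * Real.sqrt (1 - 8 * x ^ 2)) / (2 * ((1 + x ^ 2) * Real.sqrt (1 - 8 * x ^ 2)))

/-- Since √(1 - 8x²) = |1 - 3cos² k|/(1 + cos² k) at x = `drift k`, removing the absolute value with
the sign `σ` turns 3 + σ√(1 - 8x²) into 2(1 + 3cos² k)/(1 + cos² k), which cancels against 1 + x².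
-/
theorem drift_branch_density {σ k : ℝ} (hσ : σ = 1 ∨ σ = -1) (hk : 0 < σ * (3 * Real.cos k ^ 2 - 1)) :
    |(1 - 3 * Real.cos k ^ 2) / (1 + Real.cos k ^ 2) ^ 2| * driftDensity σ (drift k) = 1 := by
  have hw : 0 < 1 + Real.cos k ^ 2 := by positivity
  have hw3 : 0 < 1 + 3 * Real.cos k ^ 2 := by positivity
  have habs : |1 - 3 * Real.cos k ^ 2| = σ * (3 * Real.cos k ^ 2 - 1) := by
    have h1 : |σ| = 1 := by rcases hσ with rfl | rfl <;> simp
    rw [← abs_of_pos hk, abs_mul, h1, one_mul, abs_sub_comm]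
  rw [driftDensity, one_add_drift_sq, sqrt_one_sub_eight_drift_sq, abs_div,
    abs_of_pos (pow_pos hw 2), habs]
  set r := σ * (3 * Real.cos k ^ 2 - 1) with hr
  have hrσ : σ * r = 3 * Real.cos k ^ 2 - 1 := by
    rw [hr]
    rcases hσ with rfl | rfl <;> ring
  have : 3 + σ * (r / (1 + Real.cos k ^ 2))
      = 2 * (1 + 3 * Real.cos k ^ 2) / (1 + Real.cos k ^ 2) := by
    rw [eq_div_iff hw.ne', add_mul, mul_assoc, div_mul_cancel₀ _ hw.ne', hrσ]
    ring
  rw [this]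
  field_simp

/-- The wave number at which `drift` is minimal. -/
def turn : ℝ := Real.arccos (1 / Real.sqrt 3)

theorem sqrt_three_inv_lt : 1 / Real.sqrt 3 < 1 := by
  rw [div_lt_one (by positivity)]
  exact Real.lt_sqrt_of_sq_lt (by norm_num)

theorem cos_turn : Real.cos turn = 1 / Real.sqrt 3 := by
  have : 0 < 1 / Real.sqrt 3 := by positivity
  exact Real.cos_arccos (by linarith) sqrt_three_inv_lt.le

theorem cos_turn_sq : Real.cos turn ^ 2 = 1 / 3 := by
  rw [cos_turn, div_pow, Real.sq_sqrt (by norm_num), one_pow]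

theorem turn_pos : 0 < turn := Real.arccos_pos.mpr sqrt_three_inv_lt

theorem turn_lt : turn < Real.pi / 2 := Real.arccos_lt_pi_div_two.mpr (by positivity)

theorem drift_turn : drift turn = -(1 / Real.sqrt 8) := by
  have h1 : Real.sin turn = Real.sqrt 2 / Real.sqrt 3 := by
    have : Real.sin turn ^ 2 = 2 / 3 := by linarith [Real.sin_sq_add_cos_sq turn, cos_turn_sq]
    rw [← Real.sqrt_div (by norm_num), ← this, Real.sqrt_sq]
    exact (Real.sin_pos_of_pos_of_lt_pi turn_pos (by linarith [turn_lt, Real.pi_pos])).le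
  have h8 : Real.sqrt 8 = 2 * Real.sqrt 2 := by
    rw [show (8 : ℝ) = 2 ^ 2 * 2 by norm_num, Real.sqrt_mul (by norm_num), Real.sqrt_sq (by norm_num)]
  have h3 : Real.sqrt 3 ^ 2 = 3 := Real.sq_sqrt (by norm_num)
  have h2 : Real.sqrt 2 ^ 2 = 2 := Real.sq_sqrt (by norm_num)
  rw [drift_eq, cos_turn_sq, cos_turn, h1, h8]
  field_simp
  rw [h3, h2]
  norm_num

theorem drift_neg (k : ℝ) : drift (-k) = -drift k := by simp [drift_eq, neg_div]

theorem lt_cos_sq {k : ℝ} (hk : k ∈ Set.Ioo (-turn) turn) : 1 / 3 < Real.cos k ^ 2 := by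
  have h1 : Real.cos turn < Real.cos k := by
    rw [← Real.cos_abs k]
    exact Real.cos_lt_cos_of_nonneg_of_le_pi (abs_nonneg _) (by linarith [turn_lt, Real.pi_pos])
      (abs_lt.mpr hk)
  have h2 : 0 < Real.cos turn := by rw [cos_turn]; positivity
  rw [← cos_turn_sq]
  exact pow_lt_pow_left₀ h1 h2.le (by norm_num)

theorem cos_sq_lt {k : ℝ} (hk : k ∈ Set.Ioo turn (Real.pi - turn)) : Real.cos k ^ 2 < 1 / 3 := by
  have h1 : Real.cos k < Real.cos turn :=
    Real.cos_lt_cos_of_nonneg_of_le_pi turn_pos.le (by linarith [hk.2, turn_pos]) hk.1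
  have h2 : -Real.cos turn < Real.cos k := by
    rw [← Real.cos_pi_sub]
    exact Real.cos_lt_cos_of_nonneg_of_le_pi (by linarith [hk.1, turn_pos])
      (by linarith [turn_pos]) hk.2
  rw [← cos_turn_sq]
  exact sq_lt_sq' h2 h1

theorem strictAntiOn_drift : StrictAntiOn drift (Set.Icc (-turn) turn) := by
  refine strictAntiOn_of_deriv_neg (convex_Icc _ _) continuous_drift.continuousOn fun k hk => ?_
  rw [interior_Icc] at hk
  rw [(hasDerivAt_drift k).deriv]
  exact div_neg_of_neg_of_pos (by linarith [lt_cos_sq hk]) (by positivity)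

theorem strictMonoOn_drift : StrictMonoOn drift (Set.Icc turn (Real.pi - turn)) := by
  refine strictMonoOn_of_deriv_pos (convex_Icc _ _) continuous_drift.continuousOn fun k hk => ?_
  rw [interior_Icc] at hk
  rw [(hasDerivAt_drift k).deriv]
  exact div_pos (by linarith [cos_sq_lt hk]) (by positivity)

/-- In each of the two periods of length π every interior value is taken once on a decreasing and
once on an increasing branch, separated where 3cos² k = 1. The Jacobians differ, but the terms ±√(1
- 8x²) cancel in the sum of the two densities. -/
theorem map_drift_waveLaw : (waveLaw (-turn)).map drift = limitLaw := by
  have hpi := Real.pi_pos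
  have ht := turn_pos
  have ht2 := turn_lt
  have hm : Measurable drift := continuous_drift.measurable
  have h1 := map_restrict_eq_withDensity (s := Set.Ioo (-turn) turn) (G := driftDensity 1)
    measurableSet_Ioo hm
    (fun u _ => hasDerivAt_drift u) (strictAntiOn_drift.mono Set.Ioo_subset_Icc_self).injOn
    (ContinuousOn.image_Ioo_of_strictAntiOn (by linarith) continuous_drift.continuousOn
      strictAntiOn_drift)
    (fun u hu => drift_branch_density (by simp) (by linarith [lt_cos_sq hu]))
  have h2 := map_restrict_eq_withDensity (s := Set.Ioo turn (Real.pi - turn))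
    (G := driftDensity (-1)) measurableSet_Ioo hm
    (fun u _ => hasDerivAt_drift u) (strictMonoOn_drift.mono Set.Ioo_subset_Icc_self).injOn
    (ContinuousOn.image_Ioo_of_strictMonoOn (by linarith) continuous_drift.continuousOn
      strictMonoOn_drift)
    (fun u hu => drift_branch_density (by simp) (by linarith [cos_sq_lt hu]))
  have hd : drift (Real.pi - turn) = 1 / Real.sqrt 8 := by
    rw [sub_eq_neg_add, drift_periodic, drift_neg, drift_turn, neg_neg]
  rw [drift_neg, drift_turn, neg_neg] at h1
  rw [hd, drift_turn] at h2
  have hmG : ∀ σ : ℝ, Measurable fun x : ℝ => ENNReal.ofReal (driftDensity σ x) := fun σ => by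
    unfold driftDensity
    fun_prop
  have hsplit : (volume.restrict (Set.Ioc (-turn) (-turn + 2 * Real.pi)) : Measure ℝ)
      = volume.restrict (Set.Ioc (-turn) (-turn + Real.pi))
        + volume.restrict (Set.Ioc (-turn + Real.pi) (-turn + Real.pi + Real.pi)) := by
    rw [show -turn + Real.pi + Real.pi = -turn + 2 * Real.pi by ring,
      ← Set.Ioc_union_Ioc_eq_Ioc (b := -turn + Real.pi) (by linarith) (by linarith),
      Measure.restrict_union (Set.Ioc_disjoint_Ioc_of_le le_rfl) measurableSet_Ioc]
  have hhalf : (volume.restrict (Set.Ioc (-turn) (-turn + Real.pi))).map drift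
      = (volume.restrict (Set.Ioo (-(1 / Real.sqrt 8)) (1 / Real.sqrt 8))).withDensity
        ((fun x => ENNReal.ofReal (driftDensity 1 x))
          + fun x => ENNReal.ofReal (driftDensity (-1) x)) := by
    rw [restrict_Ioc_eq_add (b := turn) (by linarith) (by linarith),
      Measure.map_add _ _ hm, h1, show -turn + Real.pi = Real.pi - turn by ring, h2,
      ← withDensity_add_left (hmG 1)]
  have hmS := (hmG 1).add (hmG (-1))
  rw [waveLaw, Measure.map_smul, hsplit, Measure.map_add _ _ hm,
    map_restrict_Ioc_of_periodic hm drift_periodic, hhalf, ← withDensity_add_left hmS,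
    ← withDensity_smul _ (hmS.add hmS), limitLaw]
  have h3 : (fun x => ENNReal.ofReal (limitDensity x))
      = (Set.Ioo (-(1 / Real.sqrt 8)) (1 / Real.sqrt 8)).indicator fun x =>
        ENNReal.ofReal (3 / (Real.pi * (1 + x ^ 2) * Real.sqrt (1 - 8 * x ^ 2))) := by
    ext x
    unfold limitDensity
    by_cases hx : x ∈ Set.Ioo (-(1 / Real.sqrt 8)) (1 / Real.sqrt 8)
    · rw [Set.indicator_of_mem hx, Set.indicator_of_mem hx]
    · rw [Set.indicator_of_notMem hx, Set.indicator_of_notMem hx, ENNReal.ofReal_zero]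
  rw [h3, withDensity_indicator measurableSet_Ioo]
  refine withDensity_congr_ae (ae_restrict_of_forall_mem measurableSet_Ioo fun x hx => ?_)
  have hx2 : x ^ 2 < 1 / 8 := by
    have := sq_lt_sq' hx.1 hx.2
    rwa [div_pow, one_pow, Real.sq_sqrt (by norm_num)] at this
  have hr : 0 < Real.sqrt (1 - 8 * x ^ 2) := Real.sqrt_pos.mpr (by linarith)
  have hr1 : Real.sqrt (1 - 8 * x ^ 2) ≤ 1 := Real.sqrt_le_one.mpr (by nlinarith)
  have h4 : 0 ≤ driftDensity 1 x := div_nonneg (by linarith) (by positivity)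
  have h5 : 0 ≤ driftDensity (-1) x := div_nonneg (by linarith) (by positivity)
  simp only [Pi.smul_apply, Pi.add_apply, smul_eq_mul]
  rw [← ENNReal.ofReal_add h4 h5, ← ENNReal.ofReal_add (by positivity) (by positivity),
    ← ENNReal.ofReal_mul (by positivity)]
  congr 1
  unfold driftDensity
  field_simp
  ring


/-! ### Characteristic functions of the limit laws. -/

instance : IsProbabilityMeasure limitLaw := by
  rw [← map_drift_waveLaw]
  exact Measure.isProbabilityMeasure_map continuous_drift.aemeasurable

instance : IsProbabilityMeasure konnoLaw := by
  rw [← map_velocity_waveLaw]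
  exact Measure.isProbabilityMeasure_map continuous_velocity.aemeasurable

instance : IsProbabilityMeasure productLaw :=
  Measure.isProbabilityMeasure_map (by fun_prop)

theorem charFun_limitLaw (θ : ℝ) :
    charFun limitLaw θ = ∫ k, Complex.exp ((θ * drift k : ℝ) * Complex.I) ∂(waveLaw (-turn)) := by
  rw [charFun_apply_real, ← map_drift_waveLaw,
    integral_map continuous_drift.aemeasurable (by fun_prop)]
  simp

/-- The Gaussian factor is integrated first, at a fixed value of the other factor; that value is
then written as `velocity k`. -/
theorem charFun_productLaw (θ : ℝ) :
    charFun productLaw θ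
      = ∫ k, Complex.exp ((-(1 / 2) * (θ ^ 2 * velocity k ^ 2) : ℝ)) ∂(waveLaw (-Real.pi)) := by
  have h1 : ∀ z : ℝ, ∫ x, Complex.exp (θ * ((x * z : ℝ) : ℂ) * Complex.I) ∂(gaussianReal 0 1)
      = Complex.exp ((-(1 / 2) * (θ ^ 2 * z ^ 2) : ℝ)) := by
    intro z
    have h2 := charFun_gaussianReal (μ := 0) (v := 1) (θ * z)
    rw [charFun_apply_real] at h2
    have h3 : ∀ x : ℝ, (θ * ((x * z : ℝ) : ℂ) * Complex.I)
        = (((θ * z : ℝ) : ℂ) * x * Complex.I) := fun x => by push_cast; ring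
    simp only [h3]
    rw [h2]
    congr 1
    push_cast
    simp
    ring
  rw [charFun_apply_real, productLaw, integral_map (by fun_prop) (by fun_prop),
    integral_prod_symm]
  · simp only [h1]
    rw [← map_velocity_waveLaw, integral_map continuous_velocity.aemeasurable (by fun_prop)]
  · refine (integrable_const (1 : ℝ)).mono' (by fun_prop) (ae_of_all _ fun x => ?_)
    rw [← Complex.ofReal_mul, Complex.norm_exp_ofReal_mul_I]

theorem charFun_mulLaw (c θ : ℝ) (P : ProbabilityMeasure ℝ) :
    charFun (mulLaw c P : Measure ℝ) θ = charFun (P : Measure ℝ) (c * θ) :=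
  charFun_map_mul c θ

theorem norm_overlap_symQubit_pow_le (d M : ℕ) (k k' : ℝ) :
    ‖overlap d symQubit k k' ^ M‖ ≤ 1 := by
  rw [norm_pow, overlap_symQubit]
  exact pow_le_one₀ (norm_nonneg _) (norm_overlap_le d k k')

theorem norm_overlapReal_pow_le (d M : ℕ) (k k' : ℝ) : ‖(overlapReal d k k' : ℂ) ^ M‖ ≤ 1 := by
  rw [norm_pow, Complex.norm_real]
  exact pow_le_one₀ (norm_nonneg _) (abs_overlapReal_le d k k')

theorem continuous_overlapReal (d : ℕ) (ε : ℝ) :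
    Continuous fun k => (overlapReal d k (k + ε) : ℂ) := by
  simp only [← half_sum_overlap_single]
  exact continuous_const.mul (continuous_finsetSum _ fun b _ => continuous_overlap _ _ _)

theorem charFun_positionB' {M : ℕ} (hM : 0 < M) (d : ℕ) (a s θ : ℝ) :
    charFun (scaledLaw (positionB M (d * M)) s : Measure ℝ) θ
      = ∫ k, (overlapReal d k (k + θ / s) : ℂ) ^ M ∂(waveLaw a) := by
  rw [charFun_positionB hM d a]
  simp only [half_sum_overlap_single]

theorem tendsto_div_natCast (θ c : ℝ) {m : ℕ → ℕ} (hm : Tendsto m atTop atTop) :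
    Tendsto (fun n => θ / (m n : ℝ) * c) atTop (𝓝 0) := by
  have := (tendsto_const_nhds (x := θ)).div_atTop ((tendsto_natCast_atTop_atTop (R := ℝ)).comp hm)
  simpa using this.mul_const c

theorem tendsto_mul_atTop_left {M : ℕ} (hM : 1 ≤ M) :
    Tendsto (fun d : ℕ => d * M) atTop atTop :=
  tendsto_atTop_mono (fun d => Nat.le_mul_of_pos_right d hM) tendsto_id

theorem tendsto_mul_atTop_right {d : ℕ} (hd : 1 ≤ d) :
    Tendsto (fun M : ℕ => d * M) atTop atTop :=
  tendsto_atTop_mono (fun M => Nat.le_mul_of_pos_left M hd) tendsto_id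

/-! ### The limit theorems. -/

theorem exists_limit_fixed_coins_B :
    ∃ Z : ℕ → ProbabilityMeasure ℝ,
      (∀ M : ℕ, 1 ≤ M →
        Tendsto (fun d : ℕ => scaledLaw (positionB M (d * M)) ((d * M : ℕ) : ℝ))
          atTop (𝓝 (Z M))) ∧
      ConvergesWeakly (fun M => mulLaw (Real.sqrt M) (Z M)) productLaw := by
  have H : ∀ M : ℕ, ∃ ν : ProbabilityMeasure ℝ, 1 ≤ M →
      Tendsto (fun d : ℕ => scaledLaw (positionB M (d * M)) ((d * M : ℕ) : ℝ)) atTop (𝓝 ν) ∧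
      (∀ θ, charFun (ν : Measure ℝ) θ
        = ∫ k, (Real.cos (velocity k * (θ / M)) : ℂ) ^ M ∂(waveLaw (-Real.pi))) ∧
      (∀ θ k : ℝ, ‖(Real.cos (velocity k * (θ / M)) : ℂ) ^ M‖ ≤ 1) ∧
      ∀ θ : ℝ, AEStronglyMeasurable (fun k => (Real.cos (velocity k * (θ / M)) : ℂ) ^ M)
        (waveLaw (-Real.pi)) := by
    intro M
    by_cases hM : 1 ≤ M
    swap
    -- An arbitrary law fills the index without a walk, so that `choose` yields a total family.
    · exact ⟨⟨limitLaw, inferInstance⟩, fun h => absurd h hM⟩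
    obtain ⟨ν, h⟩ := exists_tendsto_of_tendsto_average (-Real.pi)
      (μ := fun d : ℕ => scaledLaw (positionB M (d * M)) ((d * M : ℕ) : ℝ))
      (F := fun d θ k => (overlapReal d k (k + θ / ((d * M : ℕ) : ℝ)) : ℂ) ^ M)
      (f := fun θ k => (Real.cos (velocity k * (θ / M)) : ℂ) ^ M)
      (Eventually.of_forall fun d θ => charFun_positionB' hM d _ _ _)
      (fun d θ => (continuous_overlapReal d _).pow M)
      (fun d θ k => norm_overlapReal_pow_le _ _ _ _)
      (fun θ k => by
        refine Tendsto.pow ((Complex.continuous_ofReal.tendsto _).comp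
          (tendsto_overlapReal ?_ ?_)) M
        · simpa using tendsto_div_natCast θ 1 (tendsto_mul_atTop_left hM)
        · refine tendsto_const_nhds.congr' ?_
          filter_upwards [eventually_ne_atTop 0] with d hd
          have : (M : ℝ) ≠ 0 := by positivity
          push_cast
          field_simp)
      (fun k => by fun_prop)
    exact ⟨ν, fun _ => h⟩
  choose Z hZ using H
  refine ⟨Z, fun M hM => (hZ M hM).1, inferInstance, ?_⟩
  refine tendsto_of_tendsto_average (-Real.pi)
    (F := fun M θ k => (Real.cos (velocity k * (Real.sqrt M * θ / M)) : ℂ) ^ M) ?_ ?_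
    charFun_productLaw
  · filter_upwards [eventually_ge_atTop 1] with M hM
    obtain ⟨-, h1, h2, h3⟩ := hZ M hM
    exact ⟨fun θ => by rw [charFun_mulLaw, h1], fun θ => h2 _, fun θ => h3 _⟩
  · intro θ k
    refine tendsto_pow_exp_real tendsto_id ?_
    have h1 : ∀ n : ℕ, n ≠ 0 → Real.sqrt n * θ / n = θ / Real.sqrt n := by
      intro n hn
      have h2 : Real.sqrt n ≠ 0 := (Real.sqrt_pos.mpr (by positivity)).ne'
      have h3 : Real.sqrt n ^ 2 = n := Real.sq_sqrt (by positivity)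
      rw [div_eq_div_iff (by positivity) h2]
      linear_combination θ * h3
    have h2 : Tendsto (fun n : ℕ => velocity k * (Real.sqrt n * θ / n)) atTop (𝓝 0) := by
      have : Tendsto (fun n : ℕ => Real.sqrt n) atTop atTop :=
        Real.tendsto_sqrt_atTop.comp tendsto_natCast_atTop_atTop
      have := ((tendsto_const_nhds (x := θ)).div_atTop this).const_mul (velocity k)
      rw [mul_zero] at this
      refine this.congr' ?_
      filter_upwards [eventually_ne_atTop 0] with n hn
      rw [h1 n hn]
    have h3 := tendsto_mul_cos_sub_one' (m := fun n : ℕ => (n : ℝ))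
      (c := θ ^ 2 * velocity k ^ 2) h2 (by
        refine tendsto_const_nhds.congr' ?_
        filter_upwards [eventually_ne_atTop 0] with n hn
        have h3 : Real.sqrt n ^ 2 = n := Real.sq_sqrt (by positivity)
        rw [h1 n hn, mul_pow, div_pow, h3]
        field_simp)
    rw [show -(θ ^ 2 * velocity k ^ 2 / 2) = -(1 / 2) * (θ ^ 2 * velocity k ^ 2) by ring] at h3
    exact h3

/-- With ε = θ/√(dM) one has Mε² = θ²/d, so given `k` the limit is Gaussian of variance `speedSq d k
/ d`. -/
theorem exists_limit_fixed_uses_B :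
    ∃ Z : ℕ → ProbabilityMeasure ℝ,
      (∀ d : ℕ, 2 ≤ d →
        Tendsto (fun M : ℕ => scaledLaw (positionB M (d * M)) (Real.sqrt ((d * M : ℕ) : ℝ)))
          atTop (𝓝 (Z d))) ∧
      ConvergesWeakly (fun d => mulLaw (1 / Real.sqrt d) (Z d)) productLaw := by
  have H : ∀ d : ℕ, ∃ ν : ProbabilityMeasure ℝ, 2 ≤ d →
      Tendsto (fun M : ℕ => scaledLaw (positionB M (d * M)) (Real.sqrt ((d * M : ℕ) : ℝ)))
        atTop (𝓝 ν) ∧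
      (∀ θ, charFun (ν : Measure ℝ) θ
        = ∫ k, Complex.exp ((-(1 / 2) * (θ ^ 2 / d * speedSq d k) : ℝ)) ∂(waveLaw (-Real.pi))) ∧
      (∀ θ k : ℝ, ‖Complex.exp ((-(1 / 2) * (θ ^ 2 / d * speedSq d k) : ℝ))‖ ≤ 1) ∧
      ∀ θ : ℝ, AEStronglyMeasurable
        (fun k => Complex.exp ((-(1 / 2) * (θ ^ 2 / d * speedSq d k) : ℝ)))
        (waveLaw (-Real.pi)) := by
    intro d
    by_cases hd : 2 ≤ d
    swap
    · exact ⟨⟨limitLaw, inferInstance⟩, fun h => absurd h hd⟩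
    obtain ⟨ν, h⟩ := exists_tendsto_of_tendsto_average (-Real.pi)
      (μ := fun M : ℕ => scaledLaw (positionB M (d * M)) (Real.sqrt ((d * M : ℕ) : ℝ)))
      (F := fun M θ k => (overlapReal d k (k + θ / Real.sqrt ((d * M : ℕ) : ℝ)) : ℂ) ^ M)
      (f := fun θ k => Complex.exp ((-(1 / 2) * (θ ^ 2 / d * speedSq d k) : ℝ)))
      (by
        filter_upwards [eventually_gt_atTop 0] with M hM θ
        exact charFun_positionB' hM d _ _ _)
      (fun M θ => (continuous_overlapReal d _).pow M)
      (fun M θ k => norm_overlapReal_pow_le _ _ _ _)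
      (fun θ k => by
        refine tendsto_pow_exp_real tendsto_id
          (tendsto_smul_overlapReal_sub_one_sq (m := fun M : ℕ => (M : ℝ)) d k ?_ ?_)
        · exact (tendsto_const_nhds (x := θ)).div_atTop (Real.tendsto_sqrt_atTop.comp
            ((tendsto_natCast_atTop_atTop (R := ℝ)).comp
              (tendsto_mul_atTop_right (by omega : 1 ≤ d))))
        · refine tendsto_const_nhds.congr' ?_
          filter_upwards [eventually_ne_atTop 0] with M hM
          have h0 : (d : ℝ) ≠ 0 := by positivity
          rw [div_pow, Real.sq_sqrt (by positivity)]
          push_cast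
          field_simp)
      (fun k => by fun_prop)
    exact ⟨ν, fun _ => h⟩
  choose Z hZ using H
  refine ⟨Z, fun d hd => (hZ d hd).1, inferInstance, ?_⟩
  refine tendsto_of_tendsto_average (-Real.pi)
    (F := fun d θ k => Complex.exp
      ((-(1 / 2) * ((1 / Real.sqrt d * θ) ^ 2 / d * speedSq d k) : ℝ))) ?_ ?_
    charFun_productLaw
  · filter_upwards [eventually_ge_atTop 2] with d hd
    obtain ⟨-, h1, h2, h3⟩ := hZ d hd
    exact ⟨fun θ => by rw [charFun_mulLaw, h1], fun θ => h2 _, fun θ => h3 _⟩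
  · intro θ k
    refine ((Complex.continuous_exp.comp Complex.continuous_ofReal).tendsto _).comp ?_
    refine Tendsto.const_mul _ ?_
    -- The squared speed of the axis does not depend on `d`; after division by d² its share
    -- vanishes.
    set b := deriv tilt k ^ 2 + 2 * deriv velocity k ^ 2 with hb
    have h1 : Tendsto (fun d : ℕ => θ ^ 2 * b * (d : ℝ)⁻¹ ^ 2 * Real.sin (d * phase k) ^ 2)
        atTop (𝓝 0) := by
      refine tendsto_mul_bounded ?_ fun n => ?_
      · simpa using ((tendsto_inv_atTop_nhds_zero_nat (𝕜 := ℝ)).pow 2).const_mul (θ ^ 2 * b)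
      · rw [sq]
        exact abs_mul_sin_le (Real.abs_sin_le_one _) (Real.abs_sin_le_one _)
    have h2 := h1.const_add (θ ^ 2 * velocity k ^ 2)
    rw [add_zero] at h2
    refine h2.congr' ?_
    filter_upwards [eventually_ne_atTop 0] with d hd
    have h3 : Real.sqrt d ^ 2 = d := Real.sq_sqrt (by positivity)
    have h4 : (d : ℝ) ≠ 0 := by positivity
    rw [speedSq_eq, ← hb, mul_pow, div_pow, h3]
    field_simp

/-- With ε = θ/(dM), dε = θ/M and Mε = θ/d both tend to 0 while Mdε = θ; the relative growth of `d`
and `M` plays no role. -/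
theorem tendsto_joint_A {d M : ℕ → ℕ} (hd : Tendsto d atTop atTop) (hM : Tendsto M atTop atTop) :
    ConvergesWeakly
      (fun n => scaledLaw (positionA (M n) (d n * M n)) ((d n * M n : ℕ) : ℝ)) limitLaw := by
  refine ⟨inferInstance, ?_⟩
  refine tendsto_of_tendsto_average (-turn)
    (F := fun n θ k => overlap (d n) symQubit k (k + θ / ((d n * M n : ℕ) : ℝ)) ^ M n) ?_ ?_
    charFun_limitLaw
  · filter_upwards [hM.eventually_gt_atTop 0] with n hn
    exact ⟨fun θ => charFun_positionA hn _ _ _ _, fun θ k => norm_overlap_symQubit_pow_le _ _ _ _,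
      fun θ => ((continuous_overlap _ _ _).pow _).aestronglyMeasurable⟩
  · intro θ k
    simp only [overlap_symQubit]
    have hdM : Tendsto (fun n => d n * M n) atTop atTop := hd.atTop_mul_atTop₀ hM
    have hε : Tendsto (fun n => θ / ((d n * M n : ℕ) : ℝ)) atTop (𝓝 0) := by
      simpa using tendsto_div_natCast θ 1 hdM
    have hne : ∀ᶠ n in atTop, d n ≠ 0 ∧ M n ≠ 0 :=
      (hd.eventually_ne_atTop 0).and (hM.eventually_ne_atTop 0)
    have e1 : Tendsto (fun n => (d n : ℝ) * (θ / ((d n * M n : ℕ) : ℝ))) atTop (𝓝 0) := by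
      have := tendsto_div_natCast θ 1 hM
      refine this.congr' ?_
      filter_upwards [hne] with n hn
      have h1 := hn.1
      have h2 := hn.2
      push_cast
      field_simp
    have e2 : Tendsto (fun n => (M n : ℝ) * (θ / ((d n * M n : ℕ) : ℝ))) atTop (𝓝 0) := by
      have := tendsto_div_natCast θ 1 hd
      refine this.congr' ?_
      filter_upwards [hne] with n hn
      have h1 := hn.1
      have h2 := hn.2
      push_cast
      field_simp
    have e3 : Tendsto (fun n => (M n : ℝ) * d n * (θ / ((d n * M n : ℕ) : ℝ))) atTop (𝓝 θ) := by
      refine tendsto_const_nhds.congr' ?_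
      filter_upwards [hne] with n hn
      have h1 := hn.1
      have h2 := hn.2
      push_cast
      field_simp
    have h1 := tendsto_smul_overlapReal_sub_one (k := k) hε e1 e2 e3
    have h2 := tendsto_smul_overlapImag (k := k) (c := 0) hε e1 e3 (by
      have := tendsto_smul_increment (differentiable_tilt k).hasDerivAt hε e2
      rw [zero_mul] at this
      exact tendsto_mul_bounded this fun n =>
        abs_mul_sin_le (Real.abs_cos_le_one _) (Real.abs_sin_le_one _))
    rw [add_zero] at h2
    exact tendsto_pow_exp_mul_I hM h1 h2

theorem exists_limit_fixed_coins_A :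
    ∃ Y : ℕ → ProbabilityMeasure ℝ,
      (∀ M : ℕ, 1 ≤ M →
        Tendsto (fun d : ℕ => scaledLaw (positionA M (d * M)) ((d * M : ℕ) : ℝ))
          atTop (𝓝 (Y M))) ∧
      ConvergesWeakly Y limitLaw := by
  set f : ℕ → ℝ → ℝ → ℂ := fun M θ k => ((Real.cos (velocity k * (θ / M)) : ℂ)
    + Complex.I * (tilt k * Real.sin (velocity k * (θ / M)) : ℝ)) ^ M with hf
  have H : ∀ M : ℕ, ∃ ν : ProbabilityMeasure ℝ, 1 ≤ M →
      Tendsto (fun d : ℕ => scaledLaw (positionA M (d * M)) ((d * M : ℕ) : ℝ)) atTop (𝓝 ν) ∧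
      (∀ θ, charFun (ν : Measure ℝ) θ = ∫ k, f M θ k ∂(waveLaw (-turn))) ∧
      (∀ θ k : ℝ, ‖f M θ k‖ ≤ 1) ∧ ∀ θ : ℝ, AEStronglyMeasurable (f M θ) (waveLaw (-turn)) := by
    intro M
    by_cases hM : 1 ≤ M
    swap
    · exact ⟨⟨limitLaw, inferInstance⟩, fun h => absurd h hM⟩
    obtain ⟨ν, h⟩ := exists_tendsto_of_tendsto_average (-turn)
      (μ := fun d : ℕ => scaledLaw (positionA M (d * M)) ((d * M : ℕ) : ℝ))
      (F := fun d θ k => overlap d symQubit k (k + θ / ((d * M : ℕ) : ℝ)) ^ M)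
      (f := f M)
      (Eventually.of_forall fun d θ => charFun_positionA hM d _ _ _)
      (fun d θ => (continuous_overlap d _ _).pow M)
      (fun d θ k => norm_overlap_symQubit_pow_le _ _ _ _)
      (fun θ k => by
        simp only [overlap_symQubit]
        have hε : Tendsto (fun d : ℕ => θ / ((d * M : ℕ) : ℝ)) atTop (𝓝 0) := by
          simpa using tendsto_div_natCast θ 1 (tendsto_mul_atTop_left hM)
        have hd : Tendsto (fun d : ℕ => (d : ℝ) * (θ / ((d * M : ℕ) : ℝ))) atTop
            (𝓝 (θ / M)) := by
          refine tendsto_const_nhds.congr' ?_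
          filter_upwards [eventually_ne_atTop 0] with d hd
          have : (M : ℝ) ≠ 0 := by positivity
          push_cast
          field_simp
        exact (((Complex.continuous_ofReal.tendsto _).comp (tendsto_overlapReal hε hd)).add
          (((Complex.continuous_ofReal.tendsto _).comp
            (tendsto_overlapImag hε hd)).const_mul Complex.I)).pow M)
      (fun k => by rw [hf]; fun_prop)
    exact ⟨ν, fun _ => h⟩
  choose Y hY using H
  refine ⟨Y, fun M hM => (hY M hM).1, inferInstance, ?_⟩
  refine tendsto_of_tendsto_average (-turn) (F := f) ?_ ?_ charFun_limitLaw
  · filter_upwards [eventually_ge_atTop 1] with M hM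
    exact (hY M hM).2
  · intro θ k
    have h0 : Tendsto (fun M : ℕ => velocity k * (θ / M)) atTop (𝓝 0) :=
      (tendsto_div_natCast θ (velocity k) tendsto_id).congr fun M => by rw [mul_comm]; rfl
    have h1 : Tendsto (fun M : ℕ => (M : ℝ) * (velocity k * (θ / M))) atTop
        (𝓝 (velocity k * θ)) := by
      refine tendsto_const_nhds.congr' ?_
      filter_upwards [eventually_ne_atTop 0] with M hM
      field_simp
    have h2 := (tendsto_mul_sin h0 h1).const_mul (tilt k)
    rw [show tilt k * (velocity k * θ) = θ * drift k by rw [drift]; ring] at h2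
    exact tendsto_pow_exp_mul_I tendsto_id (tendsto_mul_cos_sub_one h0 h1)
      (h2.congr fun n => by ring)

/-- For fixed `d` the limit is still a function of `k`: the drift plus an oscillating correction
from the derivative of `tilt`, of order 1/d. -/
theorem exists_limit_fixed_uses_A :
    ∃ Y : ℕ → ProbabilityMeasure ℝ,
      (∀ d : ℕ, 2 ≤ d →
        Tendsto (fun M : ℕ => scaledLaw (positionA M (d * M)) ((d * M : ℕ) : ℝ))
          atTop (𝓝 (Y d))) ∧
      ConvergesWeakly Y limitLaw := by
  set g : ℕ → ℝ → ℝ → ℝ := fun d θ k => θ * (velocity k * tilt k)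
    + θ / d * deriv tilt k * (Real.cos (d * phase k) * Real.sin (d * phase k)) with hg
  have H : ∀ d : ℕ, ∃ ν : ProbabilityMeasure ℝ, 2 ≤ d →
      Tendsto (fun M : ℕ => scaledLaw (positionA M (d * M)) ((d * M : ℕ) : ℝ)) atTop (𝓝 ν) ∧
      (∀ θ, charFun (ν : Measure ℝ) θ
        = ∫ k, Complex.exp (g d θ k * Complex.I) ∂(waveLaw (-turn))) ∧
      (∀ θ k : ℝ, ‖Complex.exp (g d θ k * Complex.I)‖ ≤ 1) ∧
      ∀ θ : ℝ, AEStronglyMeasurable (fun k => Complex.exp (g d θ k * Complex.I))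
        (waveLaw (-turn)) := by
    intro d
    by_cases hd : 2 ≤ d
    swap
    · exact ⟨⟨limitLaw, inferInstance⟩, fun h => absurd h hd⟩
    obtain ⟨ν, h⟩ := exists_tendsto_of_tendsto_average (-turn)
      (μ := fun M : ℕ => scaledLaw (positionA M (d * M)) ((d * M : ℕ) : ℝ))
      (F := fun M θ k => overlap d symQubit k (k + θ / ((d * M : ℕ) : ℝ)) ^ M)
      (f := fun θ k => Complex.exp (g d θ k * Complex.I))
      (by
        filter_upwards [eventually_gt_atTop 0] with M hM θ
        exact charFun_positionA hM d _ _ _)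
      (fun M θ => (continuous_overlap d _ _).pow M)
      (fun M θ k => norm_overlap_symQubit_pow_le _ _ _ _)
      (fun θ k => by
        simp only [overlap_symQubit]
        have hd0 : (d : ℝ) ≠ 0 := by positivity
        have hε : Tendsto (fun M : ℕ => θ / ((d * M : ℕ) : ℝ)) atTop (𝓝 0) := by
          simpa using tendsto_div_natCast θ 1 (tendsto_mul_atTop_right (by omega : 1 ≤ d))
        have e1 : Tendsto (fun M : ℕ => (d : ℝ) * (θ / ((d * M : ℕ) : ℝ))) atTop (𝓝 0) := by
          simpa using hε.const_mul (d : ℝ)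
        have e2 : Tendsto (fun M : ℕ => (M : ℝ) * (θ / ((d * M : ℕ) : ℝ))) atTop
            (𝓝 (θ / d)) := by
          refine tendsto_const_nhds.congr' ?_
          filter_upwards [eventually_ne_atTop 0] with M hM
          push_cast
          field_simp
        have e3 : Tendsto (fun M : ℕ => (M : ℝ) * d * (θ / ((d * M : ℕ) : ℝ))) atTop
            (𝓝 θ) := by
          refine tendsto_const_nhds.congr' ?_
          filter_upwards [eventually_ne_atTop 0] with M hM
          push_cast
          field_simp
        have h1 := tendsto_smul_overlapReal_sub_one (d := fun _ => d) (k := k) hε e1 e2 e3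
        have h2 := tendsto_smul_overlapImag (d := fun _ => d) (k := k)
          (c := θ / d * deriv tilt k * (Real.cos (d * phase k) * Real.sin (d * phase k)))
          hε e1 e3 (by
            refine (tendsto_smul_increment (differentiable_tilt k).hasDerivAt hε e2).mul ?_
            have h3 : Tendsto (fun M : ℕ => k + θ / ((d * M : ℕ) : ℝ)) atTop (𝓝 k) := by
              simpa using hε.const_add k
            have h4 := (hasDerivAt_phase k).continuousAt.tendsto.comp h3
            exact ((Real.continuous_sin.tendsto _).comp (h4.const_mul (d : ℝ))).const_mul _)
        exact tendsto_pow_exp_mul_I tendsto_id h1 h2)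
      (fun k => by rw [hg]; fun_prop)
    exact ⟨ν, fun _ => h⟩
  choose Y hY using H
  refine ⟨Y, fun d hd => (hY d hd).1, inferInstance, ?_⟩
  refine tendsto_of_tendsto_average (-turn)
    (F := fun d θ k => Complex.exp (g d θ k * Complex.I)) ?_ ?_ charFun_limitLaw
  · filter_upwards [eventually_ge_atTop 2] with d hd
    exact (hY d hd).2
  · intro θ k
    have h1 : Tendsto (fun d => g d θ k) atTop (𝓝 (θ * drift k)) := by
      have := (tendsto_mul_bounded (tendsto_div_natCast θ (deriv tilt k) tendsto_id)
        (v := fun d : ℕ => Real.cos (d * phase k) * Real.sin (d * phase k)) fun n =>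
          abs_mul_sin_le (Real.abs_cos_le_one _) (Real.abs_sin_le_one _)).const_add (θ * drift k)
      rw [add_zero] at this
      exact this
    exact ((by fun_prop : Continuous fun x : ℝ => Complex.exp (x * Complex.I)).tendsto _).comp h1

/-- Applied with exponents β and 1 - β, both positive, this gives d → ∞ and M → ∞. -/
theorem tendsto_atTop_of_div_rpow {u t : ℕ → ℕ} {β : ℝ} (hβ : 0 < β) (ht : Tendsto t atTop atTop)
    (hu : Tendsto (fun n => (u n : ℝ) / (t n : ℝ) ^ β) atTop (𝓝 1)) : Tendsto u atTop atTop := by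
  have h1 : Tendsto (fun n => (t n : ℝ) ^ β) atTop atTop :=
    (tendsto_rpow_atTop hβ).comp ((tendsto_natCast_atTop_atTop (R := ℝ)).comp ht)
  have h2 := hu.pos_mul_atTop one_pos h1
  refine (tendsto_natCast_atTop_iff (R := ℝ)).mp (h2.congr' ?_)
  filter_upwards [h1.eventually_gt_atTop 0] with n hn
  exact div_mul_cancel₀ _ hn.ne'

end ManyCoinWalk

end

theorem proposition3 :
    -- `√M Z^[M] ⇒ 𝒳𝒵`, where `Z^[M]` is the weak limit of `X_t / t`, `t = dM`, as `d → ∞`, case (B)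
    (∃ Z : ℕ → ProbabilityMeasure ℝ,
      (∀ M : ℕ, 1 ≤ M →
        Tendsto (fun d : ℕ => ManyCoinWalk.scaledLaw (ManyCoinWalk.positionB M (d * M))
          ((d * M : ℕ) : ℝ)) atTop (𝓝 (Z M))) ∧
      ManyCoinWalk.ConvergesWeakly (fun M => ManyCoinWalk.mulLaw (Real.sqrt M) (Z M))
        ManyCoinWalk.productLaw) ∧
    -- `Z_d / √d ⇒ 𝒳𝒵`, where `Z_d` is the weak limit of `X_t / √t`, `t = dM`, as `M → ∞`, case (B)
    (∃ Z : ℕ → ProbabilityMeasure ℝ,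
      (∀ d : ℕ, 2 ≤ d →
        Tendsto (fun M : ℕ => ManyCoinWalk.scaledLaw (ManyCoinWalk.positionB M (d * M))
          (Real.sqrt ((d * M : ℕ) : ℝ))) atTop (𝓝 (Z d))) ∧
      ManyCoinWalk.ConvergesWeakly (fun d => ManyCoinWalk.mulLaw (1 / Real.sqrt d) (Z d))
        ManyCoinWalk.productLaw) ∧
    -- `X_t / t ⇒ Y` when `t = dM → ∞` with `d ~ t^β` and `M ~ t^(1-β)`, case (A)
    (∀ β : ℝ, 0 < β → β < 1 → ∀ d M : ℕ → ℕ,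
      Tendsto (fun n => d n * M n) atTop atTop →
      Tendsto (fun n => (d n : ℝ) / ((d n * M n : ℕ) : ℝ) ^ β) atTop (𝓝 1) →
      Tendsto (fun n => (M n : ℝ) / ((d n * M n : ℕ) : ℝ) ^ (1 - β)) atTop (𝓝 1) →
      ManyCoinWalk.ConvergesWeakly
        (fun n => ManyCoinWalk.scaledLaw (ManyCoinWalk.positionA (M n) (d n * M n))
          ((d n * M n : ℕ) : ℝ)) ManyCoinWalk.limitLaw) ∧
    -- `Y^[M] ⇒ Y`, where `Y^[M]` is the weak limit of `X_t / t`, `t = dM`, as `d → ∞`, case (A)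
    (∃ Y : ℕ → ProbabilityMeasure ℝ,
      (∀ M : ℕ, 1 ≤ M →
        Tendsto (fun d : ℕ => ManyCoinWalk.scaledLaw (ManyCoinWalk.positionA M (d * M))
          ((d * M : ℕ) : ℝ)) atTop (𝓝 (Y M))) ∧
      ManyCoinWalk.ConvergesWeakly Y ManyCoinWalk.limitLaw) ∧
    -- `Y_d ⇒ Y`, where `Y_d` is the weak limit of `X_t / t`, `t = dM`, as `M → ∞`, case (A)
    (∃ Y : ℕ → ProbabilityMeasure ℝ,
      (∀ d : ℕ, 2 ≤ d →
        Tendsto (fun M : ℕ => ManyCoinWalk.scaledLaw (ManyCoinWalk.positionA M (d * M))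
          ((d * M : ℕ) : ℝ)) atTop (𝓝 (Y d))) ∧
      ManyCoinWalk.ConvergesWeakly Y ManyCoinWalk.limitLaw) := by
  refine ⟨ManyCoinWalk.exists_limit_fixed_coins_B, ManyCoinWalk.exists_limit_fixed_uses_B, ?_,
    ManyCoinWalk.exists_limit_fixed_coins_A, ManyCoinWalk.exists_limit_fixed_uses_A⟩
  intro β h0 h1 d M ht hd hM
  exact ManyCoinWalk.tendsto_joint_A (ManyCoinWalk.tendsto_atTop_of_div_rpow h0 ht hd)
    (ManyCoinWalk.tendsto_atTop_of_div_rpow (by linarith) ht hM)
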